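/- Let $\mathbb K$ be a field, $A=\mathbb K[X_1,\dots,X_n]$, and let $W=(w_1,\dots,w_n)$ be positive integers (a system of weights). The $W$-degree of the monomial $X^\alpha$ is $\sum_i w_i\alpha_i$, and a polynomial is $W$-homogeneous of $W$-degree $d$ if all its monomials have $W$-degree $d$. Let $\hom_W\colon A\to\mathbb K[t_1,\dots,t_n]$ be the morphism $f\mapsto f(t_1^{w_1},\dots,t_n^{w_n})$. Let $F=(f_1,\dots,f_n)$ be a regular sequence in $A$ (each $f_i$ is a nonzerodivisor modulo $f_1,\dots,f_{i-1}$, and $I:=\langle f_1,\dots,f_n\rangle\neq A$), where $f_i$ is $W$-homogeneous of $W$-degree $d_i$. Then $I$ is zero-dimensional: its affine variety (over an algebraic closure of $\mathbb K$) is $\{0\}$, and $A/I$ has finite dimension over $\mathbb K$. Its degree $\deg(I):=\dim_{\mathbb K}A/I$, that is the multiplicity of the point $0$, is $$\deg(I)=\prod_{i=1}^n\frac{d_i}{w_i}.$$ Let $d_{\mathrm{reg}}(F)$ be the degree of regularity of $F$, that is the highest degree reached in a run of the F5 algorithm computing a graded reverse lexicographic Gröbner basis (with $t_1>\dots>t_n$)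 of the homogeneous system $\hom_W(F)$. Precisely, the (matrix) F5 algorithm treats the degrees $d=1,2,3,\dots$ one after the other. In degree $d$ it builds a matrix whose lines are homogeneous polynomials of degree $d$ with labels $(u,i)$, $u$ a monomial and $1\le i\le n$: for $d=d_i$ the line $\hom_W(f_i)$ with label $(1,i)$; for $d>d_i$ the lines $t_k f$ with label $(t_k e,i)$, where $f$ is a reduced line of degree $d-1$ with label $(e,i)$, no variable $t_j$ with $j>k$ divides $e$, and (F5 criterion) $t_k e$ is not the leading monomial of a reduced line of degree $d-d_i$ with a label of index less than $i$. The lines are sorted by index and then by increasing label monomial, and the matrix is brought into row echelon form without row swaps. Starting from $G=\hom_W(F)$, each line that was changed by the reduction and is nonzero is put into $G$. Then $d_{\mathrm{reg}}(F)$ is the smallest $D\ge\max_i\deg\hom_W(f_i)$ such that after the degrees $1,\dots,D$ the set $G$ is a Gröbner basis of $\langle\hom_W(F)\rangle$. Such a $D$ exists, and $$d_{\mathrm{reg}}(F)\le\sum_{i=1}^n(d_i-w_i)+\max_{1\le i\le n}w_i.$$ -/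

import Mathlib

open MvPolynomial

/-! ### The graded reverse lexicographic order -/

/-- Exponent vectors in `n` variables, to be ordered by the graded reverse lexicographic order. -/
def GRevLex (n : ℕ) : Type := Fin n →₀ ℕ

namespace GRevLex

noncomputable instance (n : ℕ) : AddCommMonoid (GRevLex n) :=
  inferInstanceAs (AddCommMonoid (Fin n →₀ ℕ))

/-- The identity map to `GRevLex n`. -/
noncomputable def equiv (n : ℕ) : (Fin n →₀ ℕ) ≃+ GRevLex n := AddEquiv.refl _

/-- Compare total degrees first; break ties by comparing the exponent vectors, read from the last
variable to the first, in the reversed lexicographic order. -/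
noncomputable def sortKey {n : ℕ} (u : GRevLex n) : ℕ ×ₗ (Lex (Fin n → ℕ))ᵒᵈ :=
  toLex (((equiv n).symm u).degree,
    OrderDual.toDual (toLex fun i : Fin n => ((equiv n).symm u) i.rev))

theorem sortKey_injective {n : ℕ} : Function.Injective (sortKey (n := n)) := by
  intro u v h
  have h2 := congrArg (fun x => (ofLex x).2) h
  simp only [sortKey, ofLex_toLex] at h2
  have h3 := toLex.injective (OrderDual.toDual.injective h2)
  apply (equiv n).symm.injective
  ext i
  have := congrFun h3 i.rev
  simpa using this

noncomputable instance (n : ℕ) : LinearOrder (GRevLex n) :=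
  LinearOrder.lift' sortKey sortKey_injective

/-- The usual description of the order: `u < v` iff `u` has smaller total degree, or the degrees
agree and, at the last variable where they differ, `u` has the larger exponent. -/
theorem lt_iff {n : ℕ} (u v : Fin n →₀ ℕ) :
    equiv n u < equiv n v ↔ u.degree < v.degree ∨
      (u.degree = v.degree ∧ ∃ i : Fin n, (∀ j, i < j → u j = v j) ∧ v i < u i) := by
  have h : equiv n u < equiv n v ↔ sortKey (equiv n u) < sortKey (equiv n v) := Iff.rfl
  rw [h]
  simp only [sortKey, AddEquiv.symm_apply_apply, Prod.Lex.toLex_lt_toLex,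
    OrderDual.toDual_lt_toDual]
  refine or_congr Iff.rfl (and_congr Iff.rfl ?_)
  constructor
  · rintro ⟨i, hi, hlt⟩
    refine ⟨i.rev, fun j hj => ?_, hlt⟩
    have := hi j.rev (show j.rev < i by rw [← Fin.rev_lt_rev, Fin.rev_rev]; exact hj)
    simpa using this.symm
  · rintro ⟨i, hi, hlt⟩
    refine ⟨i.rev, fun j hj => ?_, ?_⟩
    · exact (hi j.rev (by rw [← Fin.rev_lt_rev, Fin.rev_rev]; exact hj)).symm
    · change v i.rev.rev < u i.rev.rev
      simpa using hlt

theorem equiv_monotone (n : ℕ) : Monotone (equiv n) := by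
  intro u v huv
  rcases eq_or_ne u v with rfl | hne
  · exact le_rfl
  · refine le_of_lt ((lt_iff u v).2 (Or.inl ?_))
    obtain ⟨c, rfl⟩ := exists_add_of_le huv
    have hc : c ≠ 0 := by rintro rfl; simp at hne
    have : c.degree ≠ 0 := fun h => hc ((Finsupp.degree_eq_zero_iff c).1 h)
    rw [map_add]
    omega

instance (n : ℕ) : IsOrderedAddMonoid (GRevLex n) where
  add_le_add_left a b hab c := by
    rcases eq_or_lt_of_le hab with rfl | hlt
    · exact le_rfl
    · refine le_of_lt ?_
      obtain ⟨a, rfl⟩ := (equiv n).surjective a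
      obtain ⟨b, rfl⟩ := (equiv n).surjective b
      obtain ⟨c, rfl⟩ := (equiv n).surjective c
      rw [← map_add, ← map_add]
      rw [lt_iff] at hlt ⊢
      simpa using hlt

instance (n : ℕ) : WellFoundedLT (GRevLex n) :=
  have : WellQuasiOrderedLE (GRevLex n) :=
    Monotone.wellQuasiOrderedLE_of_wellQuasiOrderedLE_of_surjective
      (equiv_monotone n) (equiv n).surjective
  inferInstance

end GRevLex

/-- The graded reverse lexicographic monomial order with `X 0 > X 1 > ⋯ > X (n - 1)`. -/
noncomputable def grevlex (n : ℕ) : MonomialOrder (Fin n) where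
  syn := GRevLex n
  toSyn := GRevLex.equiv n
  toSyn_monotone := GRevLex.equiv_monotone n

/-- `G` is a Gröbner basis of the ideal `I` for the monomial order `ord`: it is contained in `I`,
and the leading monomial of any nonzero element of `I` is divisible by the leading monomial of some
nonzero element of `G`. -/
def IsGroebnerBasis {K σ : Type*} [Field K] (ord : MonomialOrder σ) (I : Ideal (MvPolynomial σ K))
    (G : Set (MvPolynomial σ K)) : Prop :=
  G ⊆ (I : Set (MvPolynomial σ K)) ∧
    ∀ f ∈ I, f ≠ 0 → ∃ g ∈ G, g ≠ 0 ∧ ord.degree g ≤ ord.degree f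

/-! ### The matrix-F5 algorithm

A matrix is represented by the list of its lines, a line by the polynomial whose coefficients are
its entries. -/

/-- A line of a matrix, with the label `(mon, f_idx)`. -/
structure LabeledRow (K : Type*) [Field K] (n m : ℕ) where
  /-- the index of the input polynomial in the label -/
  idx : Fin m
  /-- the exponent vector of the monomial in the label -/
  mon : Fin n →₀ ℕ
  /-- the content of the line -/
  poly : MvPolynomial (Fin n) K

namespace MatrixF5

variable {K : Type*} [Field K] {n m : ℕ}

/-- Use the (already reduced) lines `above`, one after the other, as pivots: from `p` the multiple
of each pivot line is subtracted that cancels the entry of `p` in the leading column of that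
pivot. -/
noncomputable def reduceBy (above : List (LabeledRow K n m)) (p : MvPolynomial (Fin n) K) :
    MvPolynomial (Fin n) K :=
  above.foldl (fun q r =>
    q - (q.coeff ((grevlex n).degree r.poly) / (grevlex n).leadingCoeff r.poly) • r.poly) p

/-- Row echelon form without row swaps (Gaussian elimination, where to each line only multiples of
lines above it are added). -/
noncomputable def echelonForm (M : List (LabeledRow K n m)) : List (LabeledRow K n m) :=
  M.foldl (fun above r => above ++ [{ r with poly := reduceBy above r.poly }]) []

/-- The F5 criterion for the label `(u, f_i)`. Here `T d` is the echelon form of the full matrix in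
degree `d`, so that its lines with index less than `i` form the echelon form of the matrix of
`f_1, …, f_(i-1)` in degree `d`. The criterion fails iff `u` is the leading monomial of a nonzero
line of that matrix in degree `d - deg f_i`. -/
def F5Criterion (T : ℕ → List (LabeledRow K n m)) (i : Fin m) (d di : ℕ) (u : Fin n →₀ ℕ) : Prop :=
  ¬ ∃ r ∈ T (d - di), r.idx < i ∧ r.poly ≠ 0 ∧ (grevlex n).degree r.poly = u

open Classical in
/-- The lines with index `i` of the matrix in degree `d`. If `d = deg f_i`, this is `f_i` itself. If
`d > deg f_i`, these are the products `x_k f`, where `f` runs through the reduced lines of degree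
`d - 1` with a label `(e, f_i)`, where no variable after `x_k` divides `e` (so that every monomial
is produced once), and where the label `(x_k e, f_i)` passes the F5 criterion. The lines are sorted
by increasing labels. -/
noncomputable def newRows (F : Fin m → MvPolynomial (Fin n) K)
    (T : ℕ → List (LabeledRow K n m)) (d : ℕ) (i : Fin m) : List (LabeledRow K n m) :=
  if d = (F i).totalDegree then [⟨i, 0, F i⟩]
  else if (F i).totalDegree < d then
    (((T (d - 1)).filter fun r => r.idx = i).flatMap fun r =>
      ((List.finRange n).filter fun k => (∀ j ∈ r.mon.support, j ≤ k) ∧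
          F5Criterion T i d (F i).totalDegree (r.mon + Finsupp.single k 1)).map fun k =>
        (⟨i, r.mon + Finsupp.single k 1, X k * r.poly⟩ : LabeledRow K n m)).insertionSort
      fun r s => (grevlex n).toSyn r.mon ≤ (grevlex n).toSyn s.mon
  else []

/-- The full matrix in degree `d`: the lines of index `1`, then those of index `2`, and so on. -/
noncomputable def macaulayMatrix (F : Fin m → MvPolynomial (Fin n) K)
    (T : ℕ → List (LabeledRow K n m)) (d : ℕ) : List (LabeledRow K n m) :=
  (List.finRange m).flatMap (newRows F T d)

open Classical in
/-- The state of the algorithm after the degrees `1, …, D` have been treated: the table of the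
reduced matrices obtained so far, and the current set `G`. Initially `G` consists of the input;
after a matrix has been reduced, every line that was changed and did not become zero is put into
`G`. -/
noncomputable def state (F : Fin m → MvPolynomial (Fin n) K) :
    ℕ → (ℕ → List (LabeledRow K n m)) × Set (MvPolynomial (Fin n) K)
  | 0 => (fun _ => [], Set.range F)
  | D + 1 =>
    let T := (state F D).1
    let M := macaulayMatrix F T (D + 1)
    let M' := echelonForm M
    (Function.update T (D + 1) M',
      (state F D).2 ∪ {g | ∃ rr ∈ M.zip M', g = rr.2.poly ∧ g ≠ rr.1.poly ∧ g ≠ 0})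

/-- The output of the matrix-F5 algorithm for the graded reverse lexicographic order, applied to the
homogeneous polynomials `F i` and run up to degree `D`. -/
noncomputable def output (F : Fin m → MvPolynomial (Fin n) K) (D : ℕ) :
    Set (MvPolynomial (Fin n) K) :=
  (state F D).2

end MatrixF5

/-! ### Degree and degree of regularity of a quasi-homogeneous system -/

/-- The morphism `f ↦ f(t_1 ^ w_1, …, t_n ^ w_n)`. -/
noncomputable def homW {K : Type*} [Field K] {n : ℕ} (w : Fin n → ℕ) :
    MvPolynomial (Fin n) K →ₐ[K] MvPolynomial (Fin n) K :=
  aeval fun i => X i ^ w i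

/-- The F5 run on `homW w (F 1), …, homW w (F m)` may stop after degree `D`: all input polynomials
have been taken into account, and a Gröbner basis of the ideal they generate has been found. -/
def F5Complete {K : Type*} [Field K] {n m : ℕ} (w : Fin n → ℕ)
    (F : Fin m → MvPolynomial (Fin n) K) (D : ℕ) : Prop :=
  (∀ i, (homW w (F i)).totalDegree ≤ D) ∧
    IsGroebnerBasis (grevlex n) (Ideal.span (Set.range fun i => homW w (F i)))
      (MatrixF5.output (fun i => homW w (F i)) D)

/-- The degree of regularity of the system `F` for the weights `w`: the highest degree reached in
the F5 run computing a graded reverse lexicographic Gröbner basis of `homW w (F i)`. The degrees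
are treated one after the other, until the Gröbner basis is complete (the value is `⊤` if this
never happens). -/
noncomputable def degreeOfRegularity {K : Type*} [Field K] {n m : ℕ} (w : Fin n → ℕ)
    (F : Fin m → MvPolynomial (Fin n) K) : ℕ∞ :=
  ⨅ D ∈ {D : ℕ | F5Complete w F D}, (D : ℕ∞)

/-- The affine variety of `I`, over the algebraic closure, consists of the origin only. -/
def VarietyIsOrigin {K : Type*} [Field K] {n : ℕ} (I : Ideal (MvPolynomial (Fin n) K)) : Prop :=
  ∀ x : Fin n → AlgebraicClosure K, (∀ f ∈ I, aeval x f = 0) ↔ x = 0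

/-- The degree of a quasi-homogeneous ideal whose affine variety is the origin: the multiplicity of
the origin, that is the dimension of the quotient algebra. -/
noncomputable def zeroDimDegree {K : Type*} [Field K] {n : ℕ}
    (I : Ideal (MvPolynomial (Fin n) K)) : ℕ :=
  Module.finrank K (MvPolynomial (Fin n) K ⧸ I)

/-!
The ideal `I` generated by the `f i` is treated by its Hilbert series, and the F5 run by an invariant
of its matrices.

*Hilbert series.* Adding to a homogeneous ideal a polynomial of degree `d` that is a nonzerodivisor
modulo this ideal multiplies the Hilbert series of the quotient by `1 - X ^ d`
(`hilbertSeries_sup_span_singleton`). Hence the series `H` of the quotient by `I` satisfies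
`H * ∏ (1 - X ^ w i) = ∏ (1 - X ^ d i)`, and cancelling `(1 - X) ^ n` leaves
`H * ∏ (1 + ⋯ + X ^ (w i - 1)) = ∏ (1 + ⋯ + X ^ (d i - 1))`. Both factors on the left have nonnegative
coefficients and the second one has constant coefficient `1`, so the coefficients of `H` are at most
those of the right hand side, and `H` is a polynomial (`exists_polynomial_eq_hilbertSeries`). Its
value at `1` is the dimension of the quotient, and its degree is `δ = ∑ (d i - w i)`. All polynomials
of weighted degree larger than `δ` lie in `I`; in particular powers of the variables do, so the
variety is the origin.

*Correctness of F5.* In degree `d`, the reduced line with label `(e, i)` is the product of `F i` with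
the monomial `e`, up to an element of the ideal of the previous polynomials and up to smaller
multiples of `F i`; and the labels that occur are those whose monomial is not a leading monomial of
the ideal of the previous polynomials (`MatrixF5.TableSpec`, `MatrixF5.tableSpec`). The discarded
multiples are combinations of others, so the lines span the degree `d` part of the ideal. Since the
nonzero lines of an echelon form have distinct leading monomials, every leading monomial of degree
`d` is that of a line. A nonzero line not put into the output is an input polynomial or a variable
times a line of the previous degree, so its leading monomial is divisible by that of an element of
the output (`MatrixF5.exists_mem_output_of_mem_span`). Regularity is not involved here.

*The bound.* The polynomial ring is free over the image of `X i ↦ X i ^ w i`, with the monomials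
with exponents less than the weights as a basis, and the coordinates of an element of the ideal
generated by the `homW w (f i)` lie in `I` (`residuePart_mem_span`). Therefore every leading monomial
of this ideal is divisible by a leading monomial of the image of `I`. A monomial of weighted degree
larger than `δ + max w` remains of degree larger than `δ` when it is divided by one of its variables,
so leading monomials of degree at most `δ + max w` suffice (`exists_homogeneous_degree_le`). For the
same reason, `d j > δ + max w` would put `f j` into the ideal generated by the other `f k`, which is
impossible because the coefficients of a relation between the `f k` lie in `I`
(`degree_le_of_forall_mem`).
-/

/-! ### Ideals generated by the first members of a sequence -/

section PrefixIdeal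

variable {K : Type*} [Field K] {n m : ℕ}

/-- The ideal generated by those `f j` whose index is less than `k`. -/
noncomputable def prefixIdeal (f : Fin m → MvPolynomial (Fin n) K) (k : ℕ) :
    Ideal (MvPolynomial (Fin n) K) :=
  Ideal.span (f '' {j | (j : ℕ) < k})

variable {f : Fin m → MvPolynomial (Fin n) K}

theorem prefixIdeal_zero : prefixIdeal f 0 = ⊥ := by
  simp [prefixIdeal]

theorem prefixIdeal_succ (i : Fin m) :
    prefixIdeal f (i + 1) = prefixIdeal f i ⊔ Ideal.span {f i} := by
  rw [prefixIdeal, prefixIdeal, ← Ideal.span_union]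
  congr 1
  ext p
  simp only [Set.mem_image, Set.mem_ofPred_eq, Set.mem_union, Set.mem_singleton_iff,
    Nat.lt_succ_iff_lt_or_eq]
  constructor
  · rintro ⟨j, hj | hj, rfl⟩
    · exact Or.inl ⟨j, hj, rfl⟩
    · exact Or.inr (by rw [Fin.ext hj])
  · rintro (⟨j, hj, rfl⟩ | rfl)
    · exact ⟨j, Or.inl hj, rfl⟩
    · exact ⟨i, Or.inr rfl, rfl⟩

theorem prefixIdeal_eq_span_range {k : ℕ} (hk : m ≤ k) :
    prefixIdeal f k = Ideal.span (Set.range f) := by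
  rw [prefixIdeal, ← Set.image_univ]
  congr 2
  ext j
  simpa using lt_of_lt_of_le j.2 hk

theorem prefixIdeal_mono {k l : ℕ} (h : k ≤ l) : prefixIdeal f k ≤ prefixIdeal f l :=
  Ideal.span_mono (Set.image_mono fun _ hj => lt_of_lt_of_le hj h)

theorem prefixIdeal_le_span_range (k : ℕ) : prefixIdeal f k ≤ Ideal.span (Set.range f) :=
  Ideal.span_mono (Set.image_subset_range _ _)

theorem mem_prefixIdeal {k : ℕ} {j : Fin m} (h : (j : ℕ) < k) : f j ∈ prefixIdeal f k :=
  Ideal.subset_span ⟨j, h, rfl⟩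

end PrefixIdeal

/-! ### Homogeneous components of elements of ideals -/

section Homogeneous

variable {K : Type*} [Field K] {n m : ℕ} {w : Fin n → ℕ}

theorem weightedHomogeneousComponent_mul_add {g : MvPolynomial (Fin n) K} {d : ℕ}
    (hg : IsWeightedHomogeneous w g d) (a : MvPolynomial (Fin n) K) (e : ℕ) :
    weightedHomogeneousComponent w (e + d) (a * g) = weightedHomogeneousComponent w e a * g := by
  induction a using MvPolynomial.induction_on' with
  | monomial u c =>
    have h1 := isWeightedHomogeneous_monomial w u c rfl
    rw [weightedHomogeneousComponent_of_mem (h1.mul hg), weightedHomogeneousComponent_of_mem h1]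
    by_cases h : e = Finsupp.weight w u <;> simp [h]
  | add p q hp hq => rw [add_mul, map_add, map_add, hp, hq, add_mul]

theorem weightedHomogeneousComponent_mul_of_lt {g : MvPolynomial (Fin n) K} {d e : ℕ}
    (hg : IsWeightedHomogeneous w g d) (a : MvPolynomial (Fin n) K) (he : e < d) :
    weightedHomogeneousComponent w e (a * g) = 0 := by
  induction a using MvPolynomial.induction_on' with
  | monomial u c =>
    have h1 := isWeightedHomogeneous_monomial w u c rfl
    rw [weightedHomogeneousComponent_of_mem (h1.mul hg), if_neg (by omega)]
  | add p q hp hq => rw [add_mul, map_add, hp, hq, add_zero]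

/-- The homogeneous components of an element of an ideal generated by homogeneous polynomials are
linear combinations of monomial multiples of the generators. -/
theorem weightedHomogeneousComponent_mem_span {f : Fin m → MvPolynomial (Fin n) K} {d : Fin m → ℕ}
    (hf : ∀ j, IsWeightedHomogeneous w (f j) (d j)) {S : Set (Fin m)}
    {p : MvPolynomial (Fin n) K} (hp : p ∈ Ideal.span (f '' S)) (e : ℕ) :
    weightedHomogeneousComponent w e p ∈ Submodule.span K
      {q | ∃ j ∈ S, ∃ u, Finsupp.weight w u + d j = e ∧ q = monomial u 1 * f j} := by
  have hs : Submodule.span K (Set.range fun u : Fin n →₀ ℕ => (monomial u (1 : K))) = ⊤ := by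
    have := (basisMonomials (Fin n) K).span_eq
    rwa [coe_basisMonomials] at this
  have h2 := Submodule.span_smul_of_span_eq_top hs (f '' S)
  have hp' : p ∈ (Ideal.span (f '' S)).restrictScalars K := hp
  rw [Ideal.span, ← h2] at hp'
  clear hp
  induction hp' using Submodule.span_induction with
  | mem x hx =>
    obtain ⟨_, ⟨u, rfl⟩, _, ⟨j, hj, rfl⟩, rfl⟩ := Set.mem_smul.1 hx
    have h1 := (isWeightedHomogeneous_monomial w u (1 : K) rfl).mul (hf j)
    simp only [smul_eq_mul]
    rw [weightedHomogeneousComponent_of_mem h1]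
    split_ifs with h
    · exact Submodule.subset_span ⟨j, hj, u, h.symm, rfl⟩
    · exact zero_mem _
  | zero => simp
  | add x y _ _ hx hy => rw [map_add]; exact add_mem hx hy
  | smul a x _ hx => rw [map_smul]; exact Submodule.smul_mem _ _ hx

theorem weightedHomogeneousComponent_mem_span_image {f : Fin m → MvPolynomial (Fin n) K}
    {d : Fin m → ℕ} (hf : ∀ j, IsWeightedHomogeneous w (f j) (d j)) {S : Set (Fin m)}
    {p : MvPolynomial (Fin n) K} (hp : p ∈ Ideal.span (f '' S)) (e : ℕ) :
    weightedHomogeneousComponent w e p ∈ Ideal.span (f '' S) := by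
  have h : Submodule.span K
      {q | ∃ j ∈ S, ∃ u, Finsupp.weight w u + d j = e ∧ q = monomial u 1 * f j} ≤
      (Ideal.span (f '' S)).restrictScalars K := by
    rw [Submodule.span_le]
    rintro _ ⟨j, hj, u, -, rfl⟩
    exact Ideal.mul_mem_left _ _ (Ideal.subset_span ⟨j, hj, rfl⟩)
  exact h (weightedHomogeneousComponent_mem_span hf hp e)

end Homogeneous

/-! ### Hilbert series of quotients by weighted homogeneous ideals -/

section HilbertSeries

variable {K : Type*} [Field K] {n m : ℕ} {w : Fin n → ℕ}

/-- The Hilbert series of the quotient by `I`, for the grading with weights `w`: the coefficient at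
`e` is the codimension of the part of `I` of weighted degree `e` in the space of all weighted
homogeneous polynomials of that degree. -/
noncomputable def hilbertSeries (w : Fin n → ℕ) (I : Ideal (MvPolynomial (Fin n) K)) :
    PowerSeries ℤ :=
  PowerSeries.mk fun e => (Module.finrank K (weightedHomogeneousSubmodule K w e) : ℤ) -
    Module.finrank K (weightedHomogeneousSubmodule K w e ⊓ I.restrictScalars K :
      Submodule K (MvPolynomial (Fin n) K))

theorem finite_weightedHomogeneousSubmodule (hw : ∀ i, 0 < w i) (e : ℕ) :
    Module.Finite K (weightedHomogeneousSubmodule K w e) :=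
  Module.Finite.iff_fg.2 (weightedHomogeneousSubmodule_fg K w (fun i => (hw i).ne') e)

theorem coeff_hilbertSeries_nonneg (hw : ∀ i, 0 < w i) (I : Ideal (MvPolynomial (Fin n) K))
    (e : ℕ) : 0 ≤ PowerSeries.coeff e (hilbertSeries w I) := by
  have := finite_weightedHomogeneousSubmodule (K := K) hw e
  rw [hilbertSeries, PowerSeries.coeff_mk, sub_nonneg, Nat.cast_le]
  exact Submodule.finrank_mono inf_le_left

theorem weightedHomogeneousSubmodule_le_of_coeff_eq_zero (hw : ∀ i, 0 < w i)
    {I : Ideal (MvPolynomial (Fin n) K)} {e : ℕ}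
    (h : PowerSeries.coeff e (hilbertSeries w I) = 0) :
    weightedHomogeneousSubmodule K w e ≤ I.restrictScalars K := by
  have := finite_weightedHomogeneousSubmodule (K := K) hw e
  rw [hilbertSeries, PowerSeries.coeff_mk, sub_eq_zero, Nat.cast_inj] at h
  exact inf_eq_left.1 (Submodule.eq_of_le_of_finrank_eq inf_le_left h.symm)

/-- The Hilbert series is multiplied by `1 - X ^ d` when a polynomial of degree `d` that is a
nonzerodivisor modulo the ideal is added to the ideal. -/
theorem hilbertSeries_sup_span_singleton (hw : ∀ i, 0 < w i)
    {I : Ideal (MvPolynomial (Fin n) K)}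
    (hI : ∀ p ∈ I, ∀ e, weightedHomogeneousComponent w e p ∈ I)
    {g : MvPolynomial (Fin n) K} {d : ℕ} (hg : IsWeightedHomogeneous w g d) (hg0 : g ≠ 0)
    (hreg : ∀ a, a * g ∈ I → a ∈ I) :
    hilbertSeries w (I ⊔ Ideal.span {g}) = hilbertSeries w I * (1 - PowerSeries.X ^ d) := by
  have hfin := finite_weightedHomogeneousSubmodule (K := K) hw
  have hsame : ∀ {p e}, p ∈ weightedHomogeneousSubmodule K w e →
      weightedHomogeneousComponent w e p = p := fun h => weightedHomogeneousComponent_eq_self h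
  ext e
  rw [mul_sub, mul_one, map_sub, PowerSeries.coeff_mul_X_pow']
  simp only [hilbertSeries, PowerSeries.coeff_mk]
  split_ifs with hde
  · obtain ⟨k, rfl⟩ := Nat.exists_eq_add_of_le' hde
    rw [Nat.add_sub_cancel]
    let μ : MvPolynomial (Fin n) K →ₗ[K] MvPolynomial (Fin n) K := LinearMap.mulRight K g
    have hμ : Function.Injective μ := fun a b hab => mul_right_cancel₀ hg0 hab
    have hfr : ∀ V : Submodule K (MvPolynomial (Fin n) K),
        Module.finrank K (V.map μ) = Module.finrank K V := fun V =>
      (LinearEquiv.finrank_eq (Submodule.equivMapOfInjective μ hμ V)).symm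
    set V := weightedHomogeneousSubmodule K w (k + d) with hV
    set U := weightedHomogeneousSubmodule K w k with hU
    -- In degree `k + d`, the new ideal is `I` plus the multiples of `g` by polynomials of degree `k`;
    -- the overlap consists of the multiples by elements of `I`, as `g` is a nonzerodivisor modulo `I`.
    have h1 : V ⊓ (I ⊔ Ideal.span {g}).restrictScalars K =
        (V ⊓ I.restrictScalars K) ⊔ U.map μ := by
      apply le_antisymm
      · rintro p ⟨hpV, hp⟩
        obtain ⟨x, hx, y, hy, rfl⟩ := Submodule.mem_sup.1 hp
        obtain ⟨a, rfl⟩ := Ideal.mem_span_singleton'.1 hy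
        rw [← hsame hpV, map_add, weightedHomogeneousComponent_mul_add hg]
        refine Submodule.add_mem_sup ⟨weightedHomogeneousComponent_mem w x _, hI x hx _⟩
          ⟨_, weightedHomogeneousComponent_mem w a k, rfl⟩
      · refine sup_le (inf_le_inf_left _ fun p hp => Ideal.mem_sup_left hp) ?_
        rintro _ ⟨a, ha, rfl⟩
        exact ⟨IsWeightedHomogeneous.mul ha hg,
          Ideal.mem_sup_right (Ideal.mul_mem_left _ _ (Ideal.mem_span_singleton_self g))⟩
    have h2 : (V ⊓ I.restrictScalars K) ⊓ U.map μ = (U ⊓ I.restrictScalars K).map μ := by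
      apply le_antisymm
      · rintro _ ⟨⟨-, hp⟩, ⟨a, ha, rfl⟩⟩
        exact ⟨a, ⟨ha, hreg a hp⟩, rfl⟩
      · rintro _ ⟨a, ⟨ha, haI⟩, rfl⟩
        exact ⟨⟨IsWeightedHomogeneous.mul ha hg, Ideal.mul_mem_right _ _ haI⟩, a, ha, rfl⟩
    have := hfin (k + d)
    have := hfin k
    have : FiniteDimensional K ↥(V ⊓ I.restrictScalars K) :=
      Submodule.finiteDimensional_of_le inf_le_left
    have h3 := Submodule.finrank_sup_add_finrank_inf_eq (V ⊓ I.restrictScalars K) (U.map μ)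
    rw [← h1, h2, hfr, hfr] at h3
    zify at h3
    linarith
  · rw [sub_zero]
    refine congrArg
      (fun V : Submodule K (MvPolynomial (Fin n) K) => _ - (Module.finrank K V : ℤ)) ?_
    apply le_antisymm
    · rintro p ⟨hpV, hp⟩
      refine ⟨hpV, ?_⟩
      obtain ⟨x, hx, y, hy, rfl⟩ := Submodule.mem_sup.1 hp
      obtain ⟨a, rfl⟩ := Ideal.mem_span_singleton'.1 hy
      rw [← hsame hpV, map_add, weightedHomogeneousComponent_mul_of_lt hg a (not_le.1 hde),
        add_zero]
      exact hI x hx _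
    · exact inf_le_inf_left _ fun p hp => Ideal.mem_sup_left hp

theorem finrank_weightedHomogeneousSubmodule (e : ℕ) :
    Module.finrank K (weightedHomogeneousSubmodule K w e) =
      Nat.card {u : Fin n →₀ ℕ // Finsupp.weight w u = e} := by
  rw [weightedHomogeneousSubmodule_eq_finsupp_supported]
  exact Module.finrank_eq_nat_card_basis (basisRestrictSupport K {u | Finsupp.weight w u = e})

theorem mk_dvd_mul_one_sub_X_pow {c : ℕ} (hc : 0 < c) :
    PowerSeries.mk (fun k => if c ∣ k then (1 : ℤ) else 0) * (1 - PowerSeries.X ^ c) = 1 := by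
  ext k
  rw [mul_sub, mul_one, map_sub, PowerSeries.coeff_mul_X_pow', PowerSeries.coeff_mk,
    PowerSeries.coeff_one]
  by_cases hck : c ≤ k
  · rw [if_pos hck, PowerSeries.coeff_mk, if_neg (by omega : ¬ k = 0)]
    simp only [Nat.dvd_sub_iff_left hck dvd_rfl]
    simp
  · rw [if_neg hck, sub_zero]
    refine if_congr ⟨fun h => Nat.eq_zero_of_dvd_of_lt h (by omega), ?_⟩ rfl rfl
    rintro rfl
    exact dvd_zero c

theorem finrank_weightedHomogeneousSubmodule_eq_coeff_prod (hw : ∀ i, 0 < w i) (e : ℕ) :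
    (Module.finrank K (weightedHomogeneousSubmodule K w e) : ℤ) =
      PowerSeries.coeff e
        (∏ i, PowerSeries.mk (fun k => if w i ∣ k then (1 : ℤ) else 0)) := by
  classical
  rw [finrank_weightedHomogeneousSubmodule, PowerSeries.coeff_prod]
  simp only [PowerSeries.coeff_mk]
  simp_rw [Finset.prod_ite_zero, Finset.prod_const_one]
  rw [← Finset.sum_filter, Finset.sum_const, nsmul_one, Nat.cast_inj, ← Nat.card_eq_finsetCard]
  -- A decomposition `e = ∑ i, l i` with `w i ∣ l i` is the same as the exponent vector `l i / w i`.
  refine Nat.card_congr (Equiv.ofBijective (fun u => ⟨Finsupp.equivFunOnFinite.symm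
    fun i => w i * u.1 i, ?_⟩) ⟨?_, ?_⟩)
  · have := u.2
    simp [Finsupp.weight_apply, Finsupp.sum_fintype] at this
    simp [Finset.mem_finsuppAntidiag, ← this, mul_comm]
  · intro u v h
    ext i
    have := DFunLike.congr_fun (congrArg Subtype.val h) i
    simpa [(hw i).ne'] using this
  · rintro ⟨l, hl⟩
    simp only [Finset.mem_filter, Finset.mem_finsuppAntidiag] at hl
    refine ⟨⟨Finsupp.equivFunOnFinite.symm fun i => l i / w i, ?_⟩, ?_⟩
    · simp only [Finsupp.weight_apply, Finsupp.sum_fintype, smul_eq_mul, zero_mul, implies_true]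
      rw [← hl.1.1]
      exact Finset.sum_congr rfl fun i _ => Nat.div_mul_cancel (hl.2 i (Finset.mem_univ i))
    · ext i
      exact Nat.mul_div_cancel' (hl.2 i (Finset.mem_univ i))

/-- The Hilbert series of the polynomial ring is `∏ i, 1 / (1 - X ^ w i)`. -/
theorem hilbertSeries_bot_mul_prod (hw : ∀ i, 0 < w i) :
    hilbertSeries w (⊥ : Ideal (MvPolynomial (Fin n) K)) *
      ∏ i, (1 - PowerSeries.X ^ w i) = 1 := by
  have h : hilbertSeries w (⊥ : Ideal (MvPolynomial (Fin n) K)) =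
      ∏ i, PowerSeries.mk (fun k => if w i ∣ k then (1 : ℤ) else 0) := by
    ext e
    rw [hilbertSeries, PowerSeries.coeff_mk, Submodule.restrictScalars_bot, inf_bot_eq,
      finrank_bot, Nat.cast_zero, sub_zero, finrank_weightedHomogeneousSubmodule_eq_coeff_prod hw]
  rw [h, ← Finset.prod_mul_distrib]
  exact Finset.prod_eq_one fun i _ => mk_dvd_mul_one_sub_X_pow (hw i)

/-- The Hilbert series of the quotient by a regular sequence is
`∏ i, (1 - X ^ d i) / (1 - X ^ w i)`. -/
theorem hilbertSeries_prefixIdeal_mul_prod (hw : ∀ i, 0 < w i)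
    {f : Fin m → MvPolynomial (Fin n) K} {d : Fin m → ℕ}
    (hf : ∀ j, IsWeightedHomogeneous w (f j) (d j)) (hf0 : ∀ j, f j ≠ 0)
    (hreg : ∀ (j : Fin m) a, a * f j ∈ prefixIdeal f j → a ∈ prefixIdeal f j) :
    hilbertSeries w (Ideal.span (Set.range f)) * ∏ i, (1 - PowerSeries.X ^ w i) =
      ∏ j, (1 - PowerSeries.X ^ d j) := by
  classical
  have key : ∀ k, k ≤ m → hilbertSeries w (prefixIdeal f k) * ∏ i, (1 - PowerSeries.X ^ w i) =
      ∏ j with (j : Fin m).val < k, (1 - PowerSeries.X ^ d j) := by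
    intro k
    induction k with
    | zero =>
      intro _
      simp [prefixIdeal_zero, hilbertSeries_bot_mul_prod hw]
    | succ k ih =>
      intro hk
      have hs : (Finset.univ.filter fun j : Fin m => j.val < k + 1) =
          insert ⟨k, hk⟩ (Finset.univ.filter fun j : Fin m => j.val < k) := by
        ext j
        simp [Fin.ext_iff]
        omega
      rw [hs, Finset.prod_insert (by simp), ← ih (by omega)]
      have := prefixIdeal_succ (f := f) ⟨k, hk⟩
      have hI : ∀ p ∈ prefixIdeal f k, ∀ e, weightedHomogeneousComponent w e p ∈ prefixIdeal f k :=
        fun p hp e => weightedHomogeneousComponent_mem_span_image hf hp e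
      rw [this, hilbertSeries_sup_span_singleton hw hI (hf ⟨k, hk⟩) (hf0 _) (hreg ⟨k, hk⟩)]
      ring
  have := key m le_rfl
  rw [prefixIdeal_eq_span_range le_rfl] at this
  rw [this]
  simp

/-- The Hilbert series of the quotient by a regular sequence of length `n` is a polynomial `P`,
because it has nonnegative coefficients and `P * ∏ i, (1 + X + ⋯ + X ^ (w i - 1))` is the
polynomial `∏ i, (1 + X + ⋯ + X ^ (d i - 1))`. -/
theorem exists_polynomial_eq_hilbertSeries (hw : ∀ i, 0 < w i) {I : Ideal (MvPolynomial (Fin n) K)}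
    {d : Fin n → ℕ} (hd : ∀ i, 0 < d i)
    (h : hilbertSeries w I * ∏ i, (1 - PowerSeries.X ^ w i) = ∏ j, (1 - PowerSeries.X ^ d j)) :
    ∃ P : Polynomial ℤ, (P : PowerSeries ℤ) = hilbertSeries w I ∧
      P.natDegree + ∑ i, w i = ∑ i, d i ∧ P.eval 1 * ∏ i, (w i : ℤ) = ∏ i, (d i : ℤ) := by
  let g : ℕ → Polynomial ℕ := fun c => ∑ k ∈ Finset.range c, Polynomial.X ^ k
  let φ : Polynomial ℕ →+* Polynomial ℤ := Polynomial.mapRingHom (Nat.castRingHom ℤ)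
  have hg : ∀ c, φ (g c) * (Polynomial.X - 1) = Polynomial.X ^ c - 1 := by
    intro c
    rw [← geom_sum_mul (Polynomial.X : Polynomial ℤ) c]
    simp [φ, g]
  have hgmonic : ∀ c, 0 < c → (φ (g c)).Monic := fun c hc =>
    (Polynomial.monic_geom_sum_X hc.ne').map _
  have hgdeg : ∀ c, 0 < c → (φ (g c)).natDegree + 1 = c := fun c hc => by
    have h1 := (hgmonic c hc).natDegree_mul (Polynomial.monic_X_sub_C (1 : ℤ))
    rw [Polynomial.natDegree_X_sub_C, Polynomial.C_1, hg, ← Polynomial.C_1,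
      Polynomial.natDegree_X_pow_sub_C] at h1
    exact h1.symm
  have hgeval : ∀ c, (φ (g c)).eval 1 = c := fun c => by
    simp [φ, g, Polynomial.eval_finsetSum]
  have hdegprod : ∀ c : Fin n → ℕ, (∀ i, 0 < c i) →
      (∏ i, φ (g (c i))).natDegree + n = ∑ i, c i := fun c hc => by
    rw [Polynomial.natDegree_prod_of_monic _ _ fun i _ => hgmonic _ (hc i)]
    rw [← Finset.sum_congr rfl fun i _ => hgdeg (c i) (hc i), Finset.sum_add_distrib]
    simp
  set U := ∏ i, g (w i) with hU
  set V := ∏ i, φ (g (d i)) with hV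
  let ι := Polynomial.coeToPowerSeries.ringHom (R := ℤ)
  have hι : ∀ c, (1 - PowerSeries.X ^ c : PowerSeries ℤ) =
      ι (φ (g c)) * (1 - PowerSeries.X) := fun c => by
    have := congrArg ι (hg c)
    simp only [map_mul, map_sub, map_pow, map_one] at this
    simp only [ι, Polynomial.coeToPowerSeries.ringHom_apply, Polynomial.coe_X] at this ⊢
    linear_combination this
  have hHU : hilbertSeries w I * ι (φ U) = ι V := by
    simp only [hι, Finset.prod_mul_distrib] at h
    rw [← mul_assoc] at h
    have hne : (∏ _i : Fin n, (1 - PowerSeries.X : PowerSeries ℤ)) ≠ 0 := by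
      refine Finset.prod_ne_zero_iff.2 fun _ _ h0 => ?_
      have := congrArg (PowerSeries.coeff 0) h0
      simp at this
    have := mul_right_cancel₀ hne h
    simpa [hU, hV, map_prod] using this
  have hU0 : (φ U).coeff 0 = 1 := by
    rw [Polynomial.coeff_zero_eq_eval_zero, hU, map_prod, Polynomial.eval_prod]
    refine Finset.prod_eq_one fun i _ => ?_
    have := congrArg (Polynomial.eval 0) (hg (w i))
    simp [(hw i).ne'] at this
    simpa using this
  -- All terms of the convolution are nonnegative, and one of them is the coefficient of the series.
  have hvanish : ∀ e, V.natDegree < e → PowerSeries.coeff e (hilbertSeries w I) = 0 := by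
    intro e he
    refine le_antisymm ?_ (coeff_hilbertSeries_nonneg hw I e)
    have h1 := congrArg (PowerSeries.coeff e) hHU
    rw [PowerSeries.coeff_mul] at h1
    simp only [ι, Polynomial.coeToPowerSeries.ringHom_apply, Polynomial.coeff_coe] at h1
    rw [Polynomial.coeff_eq_zero_of_natDegree_lt he] at h1
    rw [← h1]
    refine le_trans (le_of_eq ?_) (Finset.single_le_sum (fun x _ => mul_nonneg
      (coeff_hilbertSeries_nonneg hw I x.1) ?_)
      (show (e, 0) ∈ Finset.HasAntidiagonal.antidiagonal e by simp))
    · rw [hU0, mul_one]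
    · simp [φ]
  obtain ⟨P, hP⟩ : ∃ P : Polynomial ℤ, (P : PowerSeries ℤ) = hilbertSeries w I := by
    refine ⟨(hilbertSeries w I).trunc (V.natDegree + 1), ?_⟩
    ext e
    rw [Polynomial.coeff_coe, PowerSeries.coeff_trunc]
    split_ifs with he
    · rfl
    · exact (hvanish e (by omega)).symm
  have hPU : P * φ U = V := by
    apply Polynomial.coe_injective
    rw [Polynomial.coe_mul, hP]
    exact hHU
  have hUmonic : (φ U).Monic := by
    rw [hU, map_prod]
    exact Polynomial.monic_prod_of_monic _ _ fun i _ => hgmonic _ (hw i)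
  have hVmonic : V.Monic := Polynomial.monic_prod_of_monic _ _ fun i _ => hgmonic _ (hd i)
  refine ⟨P, hP, ?_, ?_⟩
  · have hP0 : P ≠ 0 := by
      rintro rfl
      exact hVmonic.ne_zero (by rw [← hPU, zero_mul])
    have h1 := Polynomial.natDegree_mul hP0 hUmonic.ne_zero
    rw [hPU] at h1
    have h2 := hdegprod d hd
    rw [← hV] at h2
    have h3 := hdegprod w hw
    rw [hU, map_prod] at h1
    omega
  · have h1 := congrArg (Polynomial.eval 1) hPU
    rw [hV, hU, map_prod, Polynomial.eval_mul, Polynomial.eval_prod, Polynomial.eval_prod] at h1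
    simpa only [hgeval] using h1

end HilbertSeries

/-! ### Quotients whose Hilbert series is a polynomial -/

section Quotient

variable {K : Type*} [Field K] {n m : ℕ} {w : Fin n → ℕ}

/-- The dimension of the quotient by a subspace that is compatible with finitely many independent
components: `c i` is the projection to the component `V i`. -/
theorem finite_and_finrank_quotient_of_projections {M ι : Type*} [AddCommGroup M] [Module K M]
    [Fintype ι] (V : ι → Submodule K M) [∀ i, Module.Finite K (V i)] (c : ι → M →ₗ[K] M)
    (hc : ∀ i p, c i p ∈ V i) (hself : ∀ i, ∀ p ∈ V i, c i p = p)
    (hne : ∀ i j, j ≠ i → ∀ p ∈ V j, c i p = 0) (W : Submodule K M)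
    (hW : ∀ p, p ∈ W ↔ ∀ i, c i p ∈ W) :
    Module.Finite K (M ⧸ W) ∧ (Module.finrank K (M ⧸ W) : ℤ) =
      ∑ i, ((Module.finrank K (V i) : ℤ) - Module.finrank K (V i ⊓ W : Submodule K M)) := by
  classical
  let S : ∀ i, Submodule K (V i) := fun i => W.comap (V i).subtype
  let Φ : M →ₗ[K] ∀ i, V i ⧸ S i :=
    LinearMap.pi fun i => (S i).mkQ ∘ₗ (c i).codRestrict (V i) (hc i)
  have hker : LinearMap.ker Φ = W := by
    ext p
    rw [LinearMap.mem_ker, hW, funext_iff]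
    refine forall_congr' fun i => ?_
    simp [Φ, S]
  have hsurj : Function.Surjective Φ := by
    intro y
    choose x hx using fun i => (S i).mkQ_surjective (y i)
    refine ⟨∑ i, (x i : M), ?_⟩
    funext i
    rw [← hx i]
    simp only [Φ, LinearMap.pi_apply, LinearMap.comp_apply]
    congr 1
    ext1
    rw [LinearMap.codRestrict_apply, map_sum, Finset.sum_eq_single i]
    · exact hself i _ (x i).2
    · exact fun j _ hj => hne i j hj _ (x j).2
    · simp
  let E : (M ⧸ W) ≃ₗ[K] ∀ i, V i ⧸ S i :=
    Submodule.quotEquivOfEq _ _ hker.symm ≪≫ₗ Φ.quotKerEquivOfSurjective hsurj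
  refine ⟨Module.Finite.equiv E.symm, ?_⟩
  rw [E.finrank_eq, Module.finrank_pi_fintype, Nat.cast_sum]
  refine Finset.sum_congr rfl fun i _ => ?_
  have h1 := (S i).finrank_quotient_add_finrank
  have h2 : Module.finrank K (S i) = Module.finrank K (V i ⊓ W : Submodule K M) := by
    rw [← Submodule.map_comap_subtype]
    exact (LinearEquiv.finrank_eq (Submodule.equivMapOfInjective _ (V i).injective_subtype (S i)))
  rw [← h2]
  zify at h1
  linarith

/-- The dimension of the quotient by a homogeneous ideal is the value at `1` of its Hilbert series,
if this series is a polynomial. -/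
theorem finite_and_finrank_quotient_of_hilbertSeries_eq (hw : ∀ i, 0 < w i)
    {I : Ideal (MvPolynomial (Fin n) K)}
    (hI : ∀ p ∈ I, ∀ e, weightedHomogeneousComponent w e p ∈ I)
    {P : Polynomial ℤ} (hP : (P : PowerSeries ℤ) = hilbertSeries w I) :
    Module.Finite K (MvPolynomial (Fin n) K ⧸ I) ∧
      (Module.finrank K (MvPolynomial (Fin n) K ⧸ I) : ℤ) = P.eval 1 := by
  have hfin := finite_weightedHomogeneousSubmodule (K := K) hw
  have hsum : ∀ p : MvPolynomial (Fin n) K, p ∈ I.restrictScalars K ↔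
      ∀ e : Fin (P.natDegree + 1), weightedHomogeneousComponent w (e : ℕ) p ∈
        I.restrictScalars K := by
    refine fun p => ⟨fun hp e => hI p hp e, fun hp => ?_⟩
    rw [← sum_weightedHomogeneousComponent w p,
      finsum_eq_sum _ (weightedHomogeneousComponent_finsupp p)]
    refine Submodule.sum_mem _ fun e _ => ?_
    by_cases he : e < P.natDegree + 1
    · exact hp ⟨e, he⟩
    · refine weightedHomogeneousSubmodule_le_of_coeff_eq_zero hw ?_
        (weightedHomogeneousComponent_mem w p e)
      rw [← hP, Polynomial.coeff_coe]
      exact Polynomial.coeff_eq_zero_of_natDegree_lt (by omega)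
  obtain ⟨h1, h2⟩ := finite_and_finrank_quotient_of_projections
    (fun e : Fin (P.natDegree + 1) => weightedHomogeneousSubmodule K w (e : ℕ))
    (fun e => weightedHomogeneousComponent w (e : ℕ))
    (fun e p => weightedHomogeneousComponent_mem w p e)
    (fun e p hp => weightedHomogeneousComponent_eq_self hp)
    (fun e e' hne p hp => IsWeightedHomogeneous.weightedHomogeneousComponent_ne _ hp
      fun h => hne (Fin.ext h.symm)) (I.restrictScalars K) hsum
  have E := Submodule.Quotient.restrictScalarsEquiv K I
  refine ⟨Module.Finite.equiv E, ?_⟩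
  rw [← E.finrank_eq, h2, Polynomial.eval_eq_sum_range,
    ← Fin.sum_univ_eq_sum_range fun e => P.coeff e * 1 ^ e]
  refine Finset.sum_congr rfl fun e _ => ?_
  rw [one_pow, mul_one, ← Polynomial.coeff_coe, hP, hilbertSeries, PowerSeries.coeff_mk]

/-- If all homogeneous polynomials of large degree lie in an ideal that is contained in the maximal
ideal of the origin, then its variety is the origin. -/
theorem varietyIsOrigin_of_le (hw : ∀ i, 0 < w i) {I : Ideal (MvPolynomial (Fin n) K)} {N : ℕ}
    (hN : ∀ e, N < e → weightedHomogeneousSubmodule K w e ≤ I.restrictScalars K)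
    (h0 : ∀ p ∈ I, constantCoeff p = 0) : VarietyIsOrigin I := by
  intro x
  constructor
  · intro hx
    funext i
    have h1 : (X i : MvPolynomial (Fin n) K) ^ (N + 1) ∈ I := by
      refine hN ((N + 1) * w i) ?_ ?_
      · have := Nat.mul_le_mul_left (N + 1) (hw i)
        omega
      · exact (isWeightedHomogeneous_X K w i).pow (N + 1)
    have := hx _ h1
    rw [map_pow, aeval_X] at this
    exact eq_zero_of_pow_eq_zero this
  · rintro rfl p hp
    rw [show (0 : Fin n → AlgebraicClosure K) = fun _ => 0 from rfl]
    simp [aeval_zero', h0 p hp]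

end Quotient

/-! ### Regular sequences and their relations -/

section Regular

variable {K : Type*} [Field K] {n m : ℕ} {w : Fin n → ℕ}

theorem ofList_take_ofFn (f : Fin m → MvPolynomial (Fin n) K) (k : ℕ) :
    Ideal.ofList ((List.ofFn f).take k) = prefixIdeal f k := by
  rw [Ideal.ofList, prefixIdeal]
  congr 1
  ext p
  simp only [Set.mem_ofPred_eq, Set.mem_image, List.mem_take_iff_getElem, List.getElem_ofFn,
    List.length_ofFn]
  constructor
  · rintro ⟨i, hi, rfl⟩
    exact ⟨⟨i, by omega⟩, by simp; omega, rfl⟩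
  · rintro ⟨j, hj, rfl⟩
    exact ⟨j, by have := j.2; omega, rfl⟩

theorem mem_prefixIdeal_of_isWeaklyRegular {f : Fin m → MvPolynomial (Fin n) K}
    (h : RingTheory.Sequence.IsWeaklyRegular (MvPolynomial (Fin n) K) (List.ofFn f)) (j : Fin m)
    (a : MvPolynomial (Fin n) K) (ha : a * f j ∈ prefixIdeal f j) : a ∈ prefixIdeal f j := by
  have h1 := h.regular_mod_prev j (by simp)
  rw [ofList_take_ofFn, smul_eq_mul, Ideal.mul_top, List.getElem_ofFn] at h1
  exact mem_of_isSMulRegular_quotient_of_smul_mem h1 (by rwa [smul_eq_mul, mul_comm])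

/-- The coefficients of a linear relation between the members of a regular sequence lie in the
ideal generated by the sequence. -/
theorem coeff_mem_of_sum_mul_eq_zero {f : Fin m → MvPolynomial (Fin n) K}
    (hreg : ∀ (j : Fin m) a, a * f j ∈ prefixIdeal f j → a ∈ prefixIdeal f j)
    (a : Fin m → MvPolynomial (Fin n) K) (ha : ∑ j, a j * f j = 0) (j : Fin m) :
    a j ∈ Ideal.span (Set.range f) := by
  classical
  have key : ∀ k, k ≤ m → ∀ a : Fin m → MvPolynomial (Fin n) K,
      ∑ j with (j : Fin m).val < k, a j * f j = 0 →
      ∀ j : Fin m, j.val < k → a j ∈ Ideal.span (Set.range f) := by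
    intro k
    induction k with
    | zero => intro _ _ _ j hj; omega
    | succ k ih =>
      intro hk a ha j hj
      let i : Fin m := ⟨k, hk⟩
      have hs : (Finset.univ.filter fun j : Fin m => j.val < k + 1) =
          insert i (Finset.univ.filter fun j : Fin m => j.val < k) := by
        ext j
        simp [i, Fin.ext_iff]
        omega
      rw [hs, Finset.sum_insert (by simp [i])] at ha
      have hmem : a i ∈ prefixIdeal f i := by
        refine hreg i _ ?_
        rw [eq_neg_of_add_eq_zero_left ha]
        refine neg_mem (Ideal.sum_mem _ fun j hj => Ideal.mul_mem_left _ _ (mem_prefixIdeal ?_))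
        simpa [i] using (Finset.mem_filter.1 hj).2
      obtain ⟨b, hb⟩ : ∃ b : Fin m → MvPolynomial (Fin n) K,
          ∑ j with (j : Fin m).val < k, b j * f j = a i := by
        have h3 : a i ∈ Submodule.span (MvPolynomial (Fin n) K)
            (f '' ((Finset.univ.filter fun j : Fin m => j.val < k) : Set (Fin m))) := by
          simpa [prefixIdeal, i] using hmem
        exact (Submodule.mem_span_image_finset_iff_exists_fun' (MvPolynomial (Fin n) K)).1 h3
      -- Substituting the expression of the last coefficient gives a relation of the other
      -- members.
      have h2 := ih (by omega) (fun j => a j + b j * f i) (by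
        rw [← ha, ← hb, Finset.sum_mul, ← Finset.sum_add_distrib]
        exact Finset.sum_congr rfl fun j _ => by ring)
      rcases Nat.lt_succ_iff_lt_or_eq.1 hj with h | h
      · have h3 := Ideal.sub_mem _ (h2 j h) (Ideal.mul_mem_left _ (b j)
          (Ideal.subset_span (Set.mem_range_self i) : f i ∈ Ideal.span (Set.range f)))
        simpa using h3
      · obtain rfl : j = i := Fin.ext h
        exact prefixIdeal_le_span_range _ hmem
  exact key m le_rfl a (by simpa using ha) j j.2

end Regular

/-! ### Leading monomials and row echelon forms -/

section Echelon

variable {K : Type*} [Field K] {n m : ℕ}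

/-- A nonzero linear combination of polynomials with distinct leading monomials has one of these as
its leading monomial. -/
theorem exists_degree_eq_of_mem_span {σ : Type*} (ord : MonomialOrder σ)
    {l : List (MvPolynomial σ K)}
    (hl : l.Pairwise fun p q => p ≠ 0 → q ≠ 0 → ord.degree p ≠ ord.degree q)
    {p : MvPolynomial σ K} (hp : p ∈ Submodule.span K {q | q ∈ l}) (hp0 : p ≠ 0) :
    ∃ q ∈ l, q ≠ 0 ∧ ord.degree q = ord.degree p := by
  induction l generalizing p with
  | nil => simp at hp; exact absurd hp hp0
  | cons a l ih =>
    rw [List.pairwise_cons] at hl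
    have hs : {q | q ∈ a :: l} = insert a {q | q ∈ l} := by ext; simp
    rw [hs, Submodule.mem_span_insert] at hp
    obtain ⟨c, z, hz, rfl⟩ := hp
    by_cases hca : c • a = 0
    · rw [hca, zero_add] at hp0 ⊢
      obtain ⟨q, hq, h1, h2⟩ := ih hl.2 hz hp0
      exact ⟨q, List.mem_cons_of_mem _ hq, h1, h2⟩
    have hc : c ≠ 0 := fun h => hca (by rw [h, zero_smul])
    have ha : a ≠ 0 := fun h => hca (by rw [h, smul_zero])
    have hdeg : ord.degree (c • a) = ord.degree a :=
      ord.degree_smul_of_isRegular (IsRegular.of_ne_zero hc)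
    by_cases hz0 : z = 0
    · rw [hz0, add_zero, hdeg]
      exact ⟨a, List.mem_cons_self, ha, rfl⟩
    obtain ⟨q, hq, h1, h2⟩ := ih hl.2 hz hz0
    have hne : ord.degree (c • a) ≠ ord.degree z := by
      rw [hdeg, ← h2]
      exact hl.1 q hq ha h1
    have h3 := ord.degree_add_of_ne hne
    rcases max_choice (ord.toSyn (ord.degree (c • a))) (ord.toSyn (ord.degree z)) with h4 | h4
    · rw [h4] at h3
      exact ⟨a, List.mem_cons_self, ha, by rw [← hdeg, ord.toSyn.injective h3]⟩
    · rw [h4] at h3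
      exact ⟨q, List.mem_cons_of_mem _ hq, h1, by rw [h2, ord.toSyn.injective h3]⟩

end Echelon

namespace MatrixF5

section Echelon

variable {K : Type*} [Field K] {n m : ℕ}

/-- The order in which the lines of a matrix are arranged: by index, then by label monomial. -/
def LabelLT (r s : LabeledRow K n m) : Prop :=
  r.idx < s.idx ∨ r.idx = s.idx ∧ (grevlex n).toSyn r.mon < (grevlex n).toSyn s.mon

theorem echelonForm_append_singleton (M : List (LabeledRow K n m)) (r : LabeledRow K n m) :
    echelonForm (M ++ [r]) =
      echelonForm M ++ [{ r with poly := reduceBy (echelonForm M) r.poly }] := by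
  simp [echelonForm, List.foldl_append]

theorem map_label_echelonForm (M : List (LabeledRow K n m)) :
    (echelonForm M).map (fun r => (r.idx, r.mon)) = M.map fun r => (r.idx, r.mon) := by
  induction M using List.reverseRecOn with
  | nil => rfl
  | append_singleton M r ih => simp [echelonForm_append_singleton, ih]

theorem length_echelonForm (M : List (LabeledRow K n m)) :
    (echelonForm M).length = M.length := by
  simpa using congrArg List.length (map_label_echelonForm M)

theorem pairwise_labelLT_echelonForm {M : List (LabeledRow K n m)} (hM : M.Pairwise LabelLT) :
    (echelonForm M).Pairwise LabelLT := by
  have h : ∀ L : List (LabeledRow K n m), L.Pairwise LabelLT ↔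
      (L.map fun r => (r.idx, r.mon)).Pairwise fun a b =>
        a.1 < b.1 ∨ a.1 = b.1 ∧ (grevlex n).toSyn a.2 < (grevlex n).toSyn b.2 := fun L => by
    rw [List.pairwise_map]
    rfl
  rw [h] at hM ⊢
  rwa [map_label_echelonForm]

theorem exists_mem_echelonForm {M : List (LabeledRow K n m)} {r : LabeledRow K n m} (hr : r ∈ M) :
    ∃ s ∈ echelonForm M, s.idx = r.idx ∧ s.mon = r.mon := by
  have : (r.idx, r.mon) ∈ (echelonForm M).map fun r => (r.idx, r.mon) := by
    rw [map_label_echelonForm]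
    exact List.mem_map_of_mem hr
  obtain ⟨s, hs, h⟩ := List.mem_map.1 this
  exact ⟨s, hs, congrArg Prod.fst h, congrArg Prod.snd h⟩

/-- A property of lines that is stable under the subtraction of multiples of earlier lines passes
from a matrix to its echelon form. -/
theorem forall_mem_echelonForm {P : LabeledRow K n m → Prop}
    (hP : ∀ r s : LabeledRow K n m, ∀ c : K, P r → P s → LabelLT s r →
      P { r with poly := r.poly - c • s.poly })
    {M : List (LabeledRow K n m)} (hM : M.Pairwise LabelLT) (h : ∀ r ∈ M, P r) :
    ∀ r ∈ echelonForm M, P r := by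
  have hred : ∀ (L : List (LabeledRow K n m)) (r : LabeledRow K n m),
      (∀ s ∈ L, P s ∧ LabelLT s r) → P r → P { r with poly := reduceBy L r.poly } := by
    intro L
    induction L with
    | nil => exact fun r _ hr => hr
    | cons s L ih =>
      intro r hL hr
      have hs := hL s List.mem_cons_self
      exact ih { r with poly := r.poly - (r.poly.coeff ((grevlex n).degree s.poly) /
          (grevlex n).leadingCoeff s.poly) • s.poly }
        (fun t ht => hL t (List.mem_cons_of_mem _ ht)) (hP r s _ hr hs.1 hs.2)
  induction M using List.reverseRecOn with
  | nil => simp [echelonForm]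
  | append_singleton M r ih =>
    have hM' := pairwise_labelLT_echelonForm hM
    rw [echelonForm_append_singleton] at hM' ⊢
    have ih' := ih (List.pairwise_append.1 hM).1 fun s hs => h s (List.mem_append_left _ hs)
    intro s hs
    rcases List.mem_append.1 hs with hs | hs
    · exact ih' s hs
    · rw [List.mem_singleton.1 hs]
      refine hred _ r (fun t ht => ⟨ih' t ht, ?_⟩) (h r (by simp))
      have hlt := (List.pairwise_append.1 hM').2.2 t ht _ (List.mem_singleton_self _)
      exact hlt

theorem coeff_reduceBy_of_forall {L : List (LabeledRow K n m)} {u : Fin n →₀ ℕ}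
    (hL : ∀ r ∈ L, r.poly.coeff u = 0) (p : MvPolynomial (Fin n) K) :
    (reduceBy L p).coeff u = p.coeff u := by
  induction L generalizing p with
  | nil => rfl
  | cons r L ih =>
    refine (ih (fun s hs => hL s (List.mem_cons_of_mem _ hs)) _).trans ?_
    rw [coeff_sub, coeff_smul, hL r List.mem_cons_self, smul_zero, sub_zero]

theorem coeff_reduceBy_eq_zero {L : List (LabeledRow K n m)}
    (hL : L.Pairwise fun r s => r.poly ≠ 0 → s.poly.coeff ((grevlex n).degree r.poly) = 0)
    (p : MvPolynomial (Fin n) K) {r : LabeledRow K n m} (hr : r ∈ L) (hr0 : r.poly ≠ 0) :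
    (reduceBy L p).coeff ((grevlex n).degree r.poly) = 0 := by
  induction L generalizing p with
  | nil => simp at hr
  | cons s L ih =>
    rw [List.pairwise_cons] at hL
    rcases List.mem_cons.1 hr with rfl | hr
    · refine (coeff_reduceBy_of_forall (fun t ht => hL.1 t ht hr0) _).trans ?_
      have : (grevlex n).leadingCoeff r.poly ≠ 0 := (grevlex n).leadingCoeff_ne_zero_iff.2 hr0
      rw [coeff_sub, coeff_smul, smul_eq_mul, ← MonomialOrder.leadingCoeff,
        div_mul_cancel₀ _ this, sub_self]
    · exact ih hL.2 _ hr

/-- A line of an echelon form vanishes in the leading columns of the nonzero lines above it: later pivots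
have themselves been reduced by the earlier ones, so they do not restore a cancelled entry. -/
theorem pairwise_coeff_echelonForm (M : List (LabeledRow K n m)) :
    (echelonForm M).Pairwise fun r s =>
      r.poly ≠ 0 → s.poly.coeff ((grevlex n).degree r.poly) = 0 := by
  induction M using List.reverseRecOn with
  | nil => simp [echelonForm]
  | append_singleton M r ih =>
    rw [echelonForm_append_singleton, List.pairwise_append]
    refine ⟨ih, List.pairwise_singleton _ _, fun s hs t ht hs0 => ?_⟩
    rw [List.mem_singleton.1 ht]
    exact coeff_reduceBy_eq_zero ih _ hs hs0

theorem pairwise_degree_ne_echelonForm (M : List (LabeledRow K n m)) :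
    (echelonForm M).Pairwise fun r s => r.poly ≠ 0 → s.poly ≠ 0 →
      (grevlex n).degree r.poly ≠ (grevlex n).degree s.poly :=
  (pairwise_coeff_echelonForm M).imp fun {r s} h hr hs heq => by
    have := h hr
    rw [heq] at this
    exact (grevlex n).coeff_degree_ne_zero_iff.2 hs this

theorem exists_mem_zip_echelonForm {M : List (LabeledRow K n m)} {s : LabeledRow K n m}
    (hs : s ∈ echelonForm M) : ∃ r ∈ M, (r, s) ∈ M.zip (echelonForm M) := by
  obtain ⟨i, hi, rfl⟩ := List.mem_iff_getElem.1 hs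
  have hi' : i < M.length := by rwa [length_echelonForm] at hi
  refine ⟨M[i], List.getElem_mem hi', List.mem_iff_getElem.2 ⟨i, ?_, ?_⟩⟩
  · simpa using ⟨hi', hi⟩
  · simp

end Echelon

/-! ### The lines and labels of the matrices -/

section Table

variable {K : Type*} [Field K] {n m : ℕ}

/-- The reduced matrix that the algorithm produces in degree `d`. -/
noncomputable def table (F : Fin m → MvPolynomial (Fin n) K) (d : ℕ) : List (LabeledRow K n m) :=
  (state F d).1 d

variable {F : Fin m → MvPolynomial (Fin n) K}

theorem state_fst_of_le {d D : ℕ} (h : d ≤ D) : (state F D).1 d = table F d := by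
  induction D with
  | zero => rw [Nat.le_zero.1 h]; rfl
  | succ D ih =>
    rcases Nat.le_succ_iff.1 h with h' | rfl
    · rw [← ih h', state]
      exact Function.update_of_ne (by omega) _ _
    · rfl

theorem table_zero : table F 0 = [] := rfl

theorem table_succ (d : ℕ) :
    table F (d + 1) = echelonForm (macaulayMatrix F (state F d).1 (d + 1)) := by
  rw [table, state]
  exact Function.update_self _ _ _

theorem pairwise_degree_ne_table (d : ℕ) :
    (table F d).Pairwise fun r s => r.poly ≠ 0 → s.poly ≠ 0 →
      (grevlex n).degree r.poly ≠ (grevlex n).degree s.poly := by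
  cases d with
  | zero => simp [table_zero]
  | succ d => rw [table_succ]; exact pairwise_degree_ne_echelonForm _

theorem mem_newRows {T : ℕ → List (LabeledRow K n m)} {d : ℕ} {i : Fin m} {r : LabeledRow K n m} :
    r ∈ newRows F T d i ↔ (d = (F i).totalDegree ∧ r = ⟨i, 0, F i⟩) ∨
      ((F i).totalDegree < d ∧ ∃ s ∈ T (d - 1), s.idx = i ∧ ∃ k, (∀ j ∈ s.mon.support, j ≤ k) ∧
        F5Criterion T i d (F i).totalDegree (s.mon + Finsupp.single k 1) ∧
        r = ⟨i, s.mon + Finsupp.single k 1, X k * s.poly⟩) := by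
  unfold newRows
  split_ifs with h1 h2
  · simp [h1]
  · rw [List.mem_insertionSort]
    simp only [List.mem_flatMap, List.mem_filter, List.mem_map, decide_eq_true_eq, List.mem_finRange,
      true_and, h1, h2, false_and, false_or]
    constructor
    · rintro ⟨s, ⟨hs, hi⟩, k, ⟨hk, hc⟩, rfl⟩
      exact ⟨s, hs, hi, k, hk, hc, rfl⟩
    · rintro ⟨s, hs, hi, k, hk, hc, rfl⟩
      exact ⟨s, ⟨hs, hi⟩, k, ⟨hk, hc⟩, rfl⟩
  · simp [h1, h2]

theorem idx_eq_of_mem_newRows {T : ℕ → List (LabeledRow K n m)} {d : ℕ} {i : Fin m}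
    {r : LabeledRow K n m} (hr : r ∈ newRows F T d i) : r.idx = i := by
  rcases mem_newRows.1 hr with ⟨-, rfl⟩ | ⟨-, s, -, -, k, -, -, rfl⟩ <;> rfl

/-- An exponent vector `u` is obtained in only one way by raising the exponent of a variable that is
not followed by a variable occurring in `u`. -/
theorem add_single_inj {u v : Fin n →₀ ℕ} {k l : Fin n} (hu : ∀ j ∈ u.support, j ≤ k)
    (hv : ∀ j ∈ v.support, j ≤ l) (h : u + Finsupp.single k 1 = v + Finsupp.single l 1) :
    u = v ∧ k = l := by
  have hkl : ∀ {u v : Fin n →₀ ℕ} {k l : Fin n}, (∀ j ∈ v.support, j ≤ l) →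
      u + Finsupp.single k 1 = v + Finsupp.single l 1 → k ≤ l := by
    intro u v k l hv h
    by_contra hlt
    have h1 := DFunLike.congr_fun h k
    have h2 : v k = 0 := by
      by_contra h3
      exact hlt (hv k (Finsupp.mem_support_iff.2 h3))
    have h3 : l ≠ k := by rintro rfl; exact hlt le_rfl
    simp [h2, h3] at h1
  have hk : k = l := le_antisymm (hkl hv h) (hkl hu h.symm)
  subst hk
  exact ⟨add_right_cancel h, rfl⟩

theorem pairwise_labelLT_newRows {T : ℕ → List (LabeledRow K n m)} {d : ℕ}
    (hT : (T (d - 1)).Pairwise LabelLT) (i : Fin m) : (newRows F T d i).Pairwise LabelLT := by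
  suffices h : (newRows F T d i).Pairwise fun r s =>
      (grevlex n).toSyn r.mon < (grevlex n).toSyn s.mon from
    h.imp_of_mem fun hr hs h =>
      Or.inr ⟨(idx_eq_of_mem_newRows hr).trans (idx_eq_of_mem_newRows hs).symm, h⟩
  unfold newRows
  split_ifs
  · exact List.pairwise_singleton _ _
  · refine List.Pairwise.imp₂ (fun r s h1 (h2 : r.mon ≠ s.mon) =>
      lt_of_le_of_ne h1 fun h => h2 ((grevlex n).toSyn.injective h))
      (List.pairwise_insertionSort _ _) ?_
    refine ((List.perm_insertionSort _ _).pairwise_iff fun h => Ne.symm h).2 ?_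
    rw [List.pairwise_flatMap]
    constructor
    · intro s _
      rw [List.pairwise_map]
      refine ((List.nodup_finRange n).filter _).imp_of_mem fun {k l} hk hl hne h => hne ?_
      have h1 := add_left_cancel h
      exact (Finsupp.single_left_inj one_ne_zero).1 h1
    -- The lines of the previous matrix have distinct labels.
    · refine (hT.filter _).imp_of_mem fun {r s} hr hs hlt => ?_
      simp only [List.mem_filter, decide_eq_true_eq, List.mem_map, List.mem_finRange, true_and]
        at hr hs ⊢
      rintro _ ⟨k, ⟨hk, -⟩, rfl⟩ _ ⟨l, ⟨hl, -⟩, rfl⟩ h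
      have h1 := (add_single_inj hk hl h).1
      rcases hlt with h2 | h2
      · exact absurd (hr.2.trans hs.2.symm) h2.ne
      · rw [h1] at h2
        exact lt_irrefl _ h2.2
  · exact List.Pairwise.nil

theorem mem_macaulayMatrix {T : ℕ → List (LabeledRow K n m)} {d : ℕ} {r : LabeledRow K n m} :
    r ∈ macaulayMatrix F T d ↔ ∃ i, r ∈ newRows F T d i := by
  simp [macaulayMatrix]

theorem pairwise_labelLT_macaulayMatrix {T : ℕ → List (LabeledRow K n m)} {d : ℕ}
    (hT : (T (d - 1)).Pairwise LabelLT) : (macaulayMatrix F T d).Pairwise LabelLT := by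
  rw [macaulayMatrix, List.pairwise_flatMap]
  refine ⟨fun i _ => pairwise_labelLT_newRows hT i, ?_⟩
  refine (List.pairwise_lt_finRange m).imp fun {i j} hij r hr s hs => Or.inl ?_
  rwa [idx_eq_of_mem_newRows hr, idx_eq_of_mem_newRows hs]

end Table

end MatrixF5

namespace MatrixF5

/-! ### Correctness of the F5 algorithm -/

section Correctness

variable {K : Type*} [Field K] {n m : ℕ} {F : Fin m → MvPolynomial (Fin n) K}

/-- The polynomials that are negligible with respect to the product of `F i` with the monomial of
exponent `e`: sums of an element of the ideal generated by the `F j` with `j < i` and of multiples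
of `F i` by smaller monomials of the same degree. -/
noncomputable def lowerSpan (F : Fin m → MvPolynomial (Fin n) K) (i : Fin m) (e : Fin n →₀ ℕ) :
    Submodule K (MvPolynomial (Fin n) K) :=
  (prefixIdeal F i).restrictScalars K ⊔ Submodule.span K
    {q | ∃ u : Fin n →₀ ℕ, u.degree = e.degree ∧ (grevlex n).toSyn u < (grevlex n).toSyn e ∧
      q = monomial u 1 * F i}

/-- A line of degree `d` whose label `(e, i)` describes it correctly: up to negligible terms, the
line is the product of `F i` with the monomial of exponent `e`. -/
structure IsLabeled (F : Fin m → MvPolynomial (Fin n) K) (d : ℕ) (r : LabeledRow K n m) : Prop where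
  degree_mon : r.mon.degree + (F r.idx).totalDegree = d
  isHomogeneous : r.poly.IsHomogeneous d
  sub_mem : r.poly - monomial r.mon 1 * F r.idx ∈ lowerSpan F r.idx r.mon

theorem lowerSpan_le_prefixIdeal (i : Fin m) (e : Fin n →₀ ℕ) :
    lowerSpan F i e ≤ (prefixIdeal F (i + 1)).restrictScalars K := by
  refine sup_le (prefixIdeal_mono (Nat.le_succ _)) (Submodule.span_le.2 ?_)
  rintro _ ⟨u, -, -, rfl⟩
  exact Ideal.mul_mem_left _ _ (mem_prefixIdeal (Nat.lt_succ_self _))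

theorem IsLabeled.mem_prefixIdeal {d : ℕ} {r : LabeledRow K n m} (h : IsLabeled F d r) {k : ℕ}
    (hk : (r.idx : ℕ) < k) : r.poly ∈ prefixIdeal F k := by
  refine prefixIdeal_mono hk ?_
  have h1 := lowerSpan_le_prefixIdeal _ _ h.sub_mem
  have h2 : monomial r.mon 1 * F r.idx ∈ prefixIdeal F (r.idx + 1) :=
    Ideal.mul_mem_left _ _ (_root_.mem_prefixIdeal (Nat.lt_succ_self _))
  have := Ideal.add_mem _ h1 h2
  simpa using this

/-- Correctness of the labels is not affected by row reduction. -/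
theorem IsLabeled.sub_smul {d : ℕ} {r s : LabeledRow K n m} (c : K) (hr : IsLabeled F d r)
    (hs : IsLabeled F d s) (hlt : LabelLT s r) :
    IsLabeled F d { r with poly := r.poly - c • s.poly } where
  degree_mon := hr.degree_mon
  isHomogeneous := hr.isHomogeneous.sub
    ((homogeneousSubmodule (Fin n) K d).smul_mem c hs.isHomogeneous)
  sub_mem := by
    have h1 : s.poly ∈ lowerSpan F r.idx r.mon := by
      rcases hlt with hlt | ⟨hi, hlt⟩
      · exact Submodule.mem_sup_left (hs.mem_prefixIdeal hlt)
      · have hdeg : s.mon.degree = r.mon.degree := by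
          have h2 := hr.degree_mon
          have h3 := hs.degree_mon
          rw [hi] at h3
          omega
        have h4 := hs.sub_mem
        rw [hi] at h4
        have h5 : lowerSpan F r.idx s.mon ≤ lowerSpan F r.idx r.mon := by
          refine sup_le_sup_left (Submodule.span_mono ?_) _
          rintro _ ⟨u, hu, hlt', rfl⟩
          exact ⟨u, hu.trans hdeg, hlt'.trans hlt, rfl⟩
        have h6 : monomial s.mon 1 * F r.idx ∈ lowerSpan F r.idx r.mon :=
          Submodule.mem_sup_right (Submodule.subset_span ⟨s.mon, hdeg, hlt, rfl⟩)
        have := Submodule.add_mem _ (h5 h4) h6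
        simpa using this
    have h2 := Submodule.sub_mem _ hr.sub_mem (Submodule.smul_mem _ c h1)
    have h3 : r.poly - c • s.poly - monomial r.mon 1 * F r.idx =
      r.poly - monomial r.mon 1 * F r.idx - c • s.poly := by ring
    rw [h3]
    exact h2

theorem IsLabeled.X_mul {d : ℕ} {r : LabeledRow K n m} (k : Fin n) (hr : IsLabeled F d r) :
    IsLabeled F (d + 1) ⟨r.idx, r.mon + Finsupp.single k 1, X k * r.poly⟩ where
  degree_mon := by
    have := hr.degree_mon
    simp only [map_add, Finsupp.degree_single]
    omega
  isHomogeneous := by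
    rw [add_comm d 1]
    exact (isHomogeneous_X K k).mul hr.isHomogeneous
  sub_mem := by
    have hX : ∀ u : Fin n →₀ ℕ, (X k : MvPolynomial (Fin n) K) * (monomial u 1 * F r.idx) =
        monomial (u + Finsupp.single k 1) 1 * F r.idx := fun u => by
      rw [← mul_assoc, X, monomial_mul, mul_one, add_comm]
    have h1 : lowerSpan F r.idx r.mon ≤
        (lowerSpan F r.idx (r.mon + Finsupp.single k 1)).comap
          (LinearMap.mulLeft K (X k : MvPolynomial (Fin n) K)) := by
      refine sup_le (fun p hp => Submodule.mem_sup_left (Ideal.mul_mem_left _ _ hp))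
        (Submodule.span_le.2 ?_)
      rintro _ ⟨u, hu, hlt, rfl⟩
      refine Submodule.mem_sup_right (Submodule.subset_span
        ⟨u + Finsupp.single k 1, by simp [hu], ?_, hX u⟩)
      rw [map_add, map_add]
      exact add_lt_add_left hlt _
    have h2 := h1 hr.sub_mem
    rw [Submodule.mem_comap, LinearMap.mulLeft_apply, mul_sub, hX] at h2
    exact h2

/-- The description of the reduced matrix in degree `d`: its lines are correctly labelled and sorted
by their labels, and the labels are the pairs `(e, i)` for which the F5 criterion does not fail. -/
structure TableSpec (F : Fin m → MvPolynomial (Fin n) K) (d : ℕ) : Prop where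
  pairwise : (table F d).Pairwise LabelLT
  isLabeled : ∀ r ∈ table F d, IsLabeled F d r
  exists_label : ∀ (i : Fin m) (e : Fin n →₀ ℕ), e.degree + (F i).totalDegree = d →
    (∀ g ∈ prefixIdeal F i, g ≠ 0 → (grevlex n).degree g ≠ e) →
      ∃ r ∈ table F d, r.idx = i ∧ r.mon = e

/-- The multiples of `F i` by monomials are reached by the lines of index at most `i`. If the label
of the multiple is discarded by the F5 criterion, an element of the ideal of the previous
polynomials with that leading monomial expresses it by smaller multiples. -/
theorem TableSpec.monomial_mul_mem_span {d : ℕ} (h : TableSpec F d)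
    (hF : ∀ i, (F i).IsHomogeneous (F i).totalDegree) (i : Fin m)
    (hprev : ∀ p ∈ prefixIdeal F i, p.IsHomogeneous d →
      p ∈ Submodule.span K {q | ∃ r ∈ table F d, (r.idx : ℕ) < i ∧ q = r.poly})
    (e : Fin n →₀ ℕ) (he : e.degree + (F i).totalDegree = d) :
    monomial e 1 * F i ∈
      Submodule.span K {q | ∃ r ∈ table F d, (r.idx : ℕ) < i + 1 ∧ q = r.poly} := by
  set S := Submodule.span K {q | ∃ r ∈ table F d, (r.idx : ℕ) < i + 1 ∧ q = r.poly} with hS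
  have hprev' : ∀ p ∈ prefixIdeal F i, p.IsHomogeneous d → p ∈ S := fun p hp hpd => by
    refine Submodule.span_mono ?_ (hprev p hp hpd)
    rintro _ ⟨r, hr, hlt, rfl⟩
    exact ⟨r, hr, Nat.lt_succ_of_lt hlt, rfl⟩
  induction e using (InvImage.wf (grevlex n).toSyn wellFounded_lt).induction with
  | _ e ih =>
  have ih' : ∀ u : Fin n →₀ ℕ, u.degree = e.degree → (grevlex n).toSyn u < (grevlex n).toSyn e →
      monomial u 1 * F i ∈ S := fun u hu hlt => ih u hlt (by rw [hu, he])
  by_cases hcrit : ∀ g ∈ prefixIdeal F i, g ≠ 0 → (grevlex n).degree g ≠ e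
  · obtain ⟨r, hr, rfl, rfl⟩ := h.exists_label i e he hcrit
    have hrl := h.isLabeled r hr
    obtain ⟨x, hx, y, hy, hxy⟩ := Submodule.mem_sup.1 hrl.sub_mem
    have hrS : r.poly ∈ S := Submodule.subset_span ⟨r, hr, Nat.lt_succ_self _, rfl⟩
    have hyS : y ∈ S := by
      refine Submodule.span_le.2 ?_ hy
      rintro _ ⟨u, hu, hlt, rfl⟩
      exact ih' u hu hlt
    have hmul : ∀ u : Fin n →₀ ℕ, u.degree = r.mon.degree →
        (monomial u (1 : K) * F r.idx).IsHomogeneous d := fun u hu => by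
      have := (isHomogeneous_monomial (1 : K) hu).mul (hF r.idx)
      rwa [he] at this
    have hyd : y ∈ homogeneousSubmodule (Fin n) K d := by
      refine Submodule.span_le.2 ?_ hy
      rintro _ ⟨u, hu, hlt, rfl⟩
      exact hmul u hu
    have hxS : x ∈ S := by
      refine hprev' x hx ?_
      rw [eq_sub_of_add_eq hxy]
      exact (hrl.isHomogeneous.sub (hmul _ rfl)).sub hyd
    have : monomial r.mon 1 * F r.idx = r.poly - (x + y) := by rw [hxy]; ring
    rw [this]
    exact Submodule.sub_mem _ hrS (Submodule.add_mem _ hxS hyS)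
  · push Not at hcrit
    obtain ⟨g, hg, hg0, rfl⟩ := hcrit
    set e := (grevlex n).degree g with he'
    -- The homogeneous component of `g` in the degree of `e` has the same leading monomial, and
    -- `q * F i` is a combination of smaller multiples of `F i`.
    set g' := homogeneousComponent e.degree g with hg'
    have hcoeff : ∀ u, g'.coeff u = if u.degree = e.degree then g.coeff u else 0 := fun u =>
      coeff_homogeneousComponent _ _ _
    have hg'mem : g' ∈ prefixIdeal F i := by
      have := weightedHomogeneousComponent_mem_span_image (w := (1 : Fin n → ℕ)) hF hg e.degree
      exact this
    have hc : g.coeff e ≠ 0 := (grevlex n).coeff_degree_ne_zero_iff.2 hg0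
    set c := g.coeff e
    set q := monomial e 1 - c⁻¹ • g' with hq
    have hqsupp : ∀ u ∈ q.support, u.degree = e.degree ∧
        (grevlex n).toSyn u < (grevlex n).toSyn e := by
      intro u hu
      rw [mem_support_iff, hq, coeff_sub, coeff_smul, hcoeff, coeff_monomial] at hu
      have hue : u ≠ e := by
        rintro rfl
        simp [c, hc] at hu
      rw [if_neg (Ne.symm hue)] at hu
      split_ifs at hu with hdeg
      · refine ⟨hdeg, lt_of_le_of_ne ((grevlex n).le_degree ?_)
          fun h => hue ((grevlex n).toSyn.injective h)⟩
        rw [mem_support_iff]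
        rintro h0
        simp [h0] at hu
      · simp at hu
    have h1 : monomial e 1 * F i = c⁻¹ • (g' * F i) + q * F i := by
      rw [hq, sub_mul, smul_mul_assoc]
      ring
    rw [h1]
    refine Submodule.add_mem _
      (Submodule.smul_mem _ _ (hprev' _ (Ideal.mul_mem_right _ _ hg'mem) ?_)) ?_
    · have := (homogeneousComponent_isHomogeneous e.degree g).mul (hF i)
      rwa [he] at this
    · rw [q.as_sum, Finset.sum_mul]
      refine Submodule.sum_mem _ fun u hu => ?_
      have : monomial u (q.coeff u) = q.coeff u • monomial u (1 : K) := by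
        rw [smul_monomial, smul_eq_mul, mul_one]
      rw [this, smul_mul_assoc]
      exact Submodule.smul_mem _ _ (ih' u (hqsupp u hu).1 (hqsupp u hu).2)

/-- The lines of index less than `k` in degree `d` span the part of degree `d` of the ideal
generated by the `F j` with `j < k`. -/
theorem TableSpec.mem_span {d : ℕ} (h : TableSpec F d)
    (hF : ∀ i, (F i).IsHomogeneous (F i).totalDegree) (k : ℕ) :
    ∀ p ∈ prefixIdeal F k, p.IsHomogeneous d →
      p ∈ Submodule.span K {q | ∃ r ∈ table F d, (r.idx : ℕ) < k ∧ q = r.poly} := by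
  induction k using Nat.strong_induction_on with
  | _ k ih =>
  intro p hp hpd
  have h1 := weightedHomogeneousComponent_mem_span (w := (1 : Fin n → ℕ)) hF hp d
  rw [weightedHomogeneousComponent_eq_self hpd] at h1
  refine Submodule.span_le.2 ?_ h1
  rintro _ ⟨j, hj, u, hu, rfl⟩
  have hu' : u.degree = Finsupp.weight 1 u := by rw [Finsupp.degree_eq_weight_one]; rfl
  rw [← hu'] at hu
  refine Submodule.span_mono ?_ (h.monomial_mul_mem_span hF j (ih j hj) u hu)
  rintro _ ⟨r, hr, hlt, rfl⟩
  exact ⟨r, hr, lt_of_lt_of_le hlt hj, rfl⟩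

/-- The leading monomials of the elements of degree `d` of the ideal generated by the `F j` with
`j < k` are those of the lines of index less than `k`. -/
theorem TableSpec.exists_degree_eq {d : ℕ} (h : TableSpec F d)
    (hF : ∀ i, (F i).IsHomogeneous (F i).totalDegree) {k : ℕ} {p : MvPolynomial (Fin n) K}
    (hp : p ∈ prefixIdeal F k) (hpd : p.IsHomogeneous d) (hp0 : p ≠ 0) :
    ∃ r ∈ table F d, (r.idx : ℕ) < k ∧ r.poly ≠ 0 ∧
      (grevlex n).degree r.poly = (grevlex n).degree p := by
  have h1 := h.mem_span hF k p hp hpd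
  let l := ((table F d).filter fun r => (r.idx : ℕ) < k).map LabeledRow.poly
  have hl : {q | q ∈ l} = {q | ∃ r ∈ table F d, (r.idx : ℕ) < k ∧ q = r.poly} := by
    ext q
    simp only [l, List.mem_map, List.mem_filter, decide_eq_true_eq, Set.mem_ofPred_eq]
    exact ⟨fun ⟨r, ⟨hr, hk⟩, hq⟩ => ⟨r, hr, hk, hq.symm⟩,
      fun ⟨r, hr, hk, hq⟩ => ⟨r, ⟨hr, hk⟩, hq.symm⟩⟩
  rw [← hl] at h1
  have hpw : l.Pairwise fun p q => p ≠ 0 → q ≠ 0 →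
      (grevlex n).degree p ≠ (grevlex n).degree q :=
    List.pairwise_map.2 ((pairwise_degree_ne_table d).filter _)
  obtain ⟨q, hq, hq0, hdeg⟩ := exists_degree_eq_of_mem_span _ hpw h1 hp0
  have hq' : q ∈ {q | q ∈ l} := hq
  rw [hl] at hq'
  obtain ⟨r, hr, hk, rfl⟩ := hq'
  exact ⟨r, hr, hk, hq0, hdeg⟩

/-- Every nonzero exponent vector arises from another one by raising the exponent of its last
variable. -/
theorem exists_add_single_of_ne_zero {e : Fin n →₀ ℕ} (he : e ≠ 0) :
    ∃ u k, e = u + Finsupp.single k 1 ∧ ∀ j ∈ u.support, j ≤ k := by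
  have hne : e.support.Nonempty := Finsupp.support_nonempty_iff.2 he
  let k := e.support.max' hne
  have hk : e k ≠ 0 := Finsupp.mem_support_iff.1 (e.support.max'_mem hne)
  refine ⟨e - Finsupp.single k 1, k, ?_, fun j hj => ?_⟩
  · rw [tsub_add_cancel_of_le]
    rw [Finsupp.single_le_iff]
    omega
  · refine e.support.le_max' j ?_
    rw [Finsupp.mem_support_iff] at hj ⊢
    rw [Finsupp.tsub_apply] at hj
    omega

theorem tableSpec (hF : ∀ i, (F i).IsHomogeneous (F i).totalDegree)
    (hpos : ∀ i, 0 < (F i).totalDegree) (d : ℕ) : TableSpec F d := by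
  induction d using Nat.strong_induction_on with
  | _ d ih =>
  cases d with
  | zero =>
    exact ⟨by simp [table_zero], by simp [table_zero], fun i e he => by have := hpos i; omega⟩
  | succ d =>
  have hprev := ih d d.lt_succ_self
  set T := (state F d).1 with hT
  have hTd : T d = table F d := state_fst_of_le le_rfl
  have hM : (macaulayMatrix F T (d + 1)).Pairwise LabelLT :=
    pairwise_labelLT_macaulayMatrix (by rw [Nat.add_sub_cancel, hTd]; exact hprev.pairwise)
  refine ⟨?_, ?_, ?_⟩
  · rw [table_succ]
    exact pairwise_labelLT_echelonForm hM
  · rw [table_succ]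
    refine forall_mem_echelonForm (fun r s c hr hs hlt => hr.sub_smul c hs hlt) hM ?_
    intro r hr
    obtain ⟨i, hi⟩ := mem_macaulayMatrix.1 hr
    rcases mem_newRows.1 hi with ⟨hd, rfl⟩ | ⟨-, s, hs, rfl, k, -, -, rfl⟩
    · refine ⟨by simp [hd], by rw [hd]; exact hF i, ?_⟩
      have : F i - monomial 0 1 * F i = 0 := by
        rw [← C_apply, C_1, one_mul, sub_self]
      simp only [this]
      exact zero_mem _
    · rw [Nat.add_sub_cancel, state_fst_of_le le_rfl] at hs
      exact (hprev.isLabeled s hs).X_mul k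
  · intro i e he hcrit
    suffices h : ∃ r ∈ newRows F T (d + 1) i, r.mon = e by
      obtain ⟨r, hr, hre⟩ := h
      obtain ⟨s, hs, h1, h2⟩ := exists_mem_echelonForm (mem_macaulayMatrix.2 ⟨i, hr⟩)
      rw [table_succ]
      exact ⟨s, hs, h1.trans (idx_eq_of_mem_newRows hr), h2.trans hre⟩
    by_cases he0 : e = 0
    · subst he0
      refine ⟨⟨i, 0, F i⟩, mem_newRows.2 (Or.inl ⟨?_, rfl⟩), rfl⟩
      simpa using he.symm
    · obtain ⟨u, k, rfl, huk⟩ := exists_add_single_of_ne_zero he0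
      have hdeg : u.degree + (F i).totalDegree = d := by
        rw [map_add, Finsupp.degree_single] at he
        omega
      obtain ⟨s, hs, hsi, rfl⟩ := hprev.exists_label i u hdeg (by
        intro g hg hg0 hgu
        refine hcrit (g * X k) (Ideal.mul_mem_right _ _ hg) (mul_ne_zero hg0 (X_ne_zero k)) ?_
        rw [MonomialOrder.degree_mul hg0 (X_ne_zero k), hgu, MonomialOrder.degree_X])
      refine ⟨⟨i, s.mon + Finsupp.single k 1, X k * s.poly⟩, mem_newRows.2 (Or.inr ⟨by omega, s,
        by rwa [Nat.add_sub_cancel, hTd], hsi, k, huk, ?_, rfl⟩), rfl⟩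
      -- The criterion refers to a matrix of smaller degree, whose lines of index less than `i`
      -- lie in the ideal of the previous polynomials.
      rintro ⟨r, hr, hri, hr0, hre⟩
      have hle : d + 1 - (F i).totalDegree ≤ d := by
        have := hpos i
        omega
      rw [hT, state_fst_of_le hle] at hr
      exact hcrit r.poly (((ih _ (Nat.lt_succ_of_le hle)).isLabeled r hr).mem_prefixIdeal hri)
        hr0 hre

theorem output_mono {d D : ℕ} (h : d ≤ D) : output F d ⊆ output F D := by
  induction h with
  | refl => exact subset_rfl
  | step _ ih => exact ih.trans Set.subset_union_left

theorem output_succ (d : ℕ) : output F (d + 1) = output F d ∪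
    {g | ∃ rr ∈ (macaulayMatrix F (state F d).1 (d + 1)).zip (table F (d + 1)),
      g = rr.2.poly ∧ g ≠ rr.1.poly ∧ g ≠ 0} := by
  rw [table_succ]
  rfl

theorem output_subset (hF : ∀ i, (F i).IsHomogeneous (F i).totalDegree)
    (hpos : ∀ i, 0 < (F i).totalDegree) (D : ℕ) :
    output F D ⊆ (Ideal.span (Set.range F) : Set (MvPolynomial (Fin n) K)) := by
  induction D with
  | zero => exact Ideal.subset_span
  | succ D ih =>
    rw [output_succ]
    refine Set.union_subset ih ?_
    rintro _ ⟨rr, hrr, rfl, -, -⟩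
    have h1 := (tableSpec hF hpos (D + 1)).isLabeled rr.2 (List.of_mem_zip hrr).2
    exact prefixIdeal_le_span_range _ (h1.mem_prefixIdeal (Nat.lt_succ_self _))

/-- The leading monomial of a reduced line is divisible by that of an element of the output: a line
that is not put into the output is an input polynomial or a multiple of a line of the previous
degree. -/
theorem exists_mem_output_of_mem_table (d : ℕ) : ∀ r ∈ table F d, r.poly ≠ 0 →
    ∃ g ∈ output F d, g ≠ 0 ∧ (grevlex n).degree g ≤ (grevlex n).degree r.poly := by
  induction d with
  | zero => simp [table_zero]
  | succ d ih =>
    intro r hr hr0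
    obtain ⟨s, hs, hzip⟩ := exists_mem_zip_echelonForm (table_succ (F := F) d ▸ hr)
    rw [← table_succ] at hzip
    by_cases hrs : r.poly = s.poly
    · rw [hrs] at hr0 ⊢
      obtain ⟨i, hi⟩ := mem_macaulayMatrix.1 hs
      rcases mem_newRows.1 hi with ⟨hd, rfl⟩ | ⟨-, t, ht, rfl, k, -, -, rfl⟩
      · exact ⟨F i, output_mono (Nat.zero_le _) (Set.mem_range_self i), hr0, le_rfl⟩
      · rw [Nat.add_sub_cancel, state_fst_of_le le_rfl] at ht
        have ht0 : t.poly ≠ 0 := right_ne_zero_of_mul hr0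
        obtain ⟨g, hg, hg0, hle⟩ := ih t ht ht0
        refine ⟨g, output_mono (Nat.le_succ d) hg, hg0, hle.trans ?_⟩
        simp only
        rw [MonomialOrder.degree_mul (X_ne_zero k) ht0]
        exact le_add_self
    · refine ⟨r.poly, ?_, hr0, le_rfl⟩
      rw [output_succ]
      exact Or.inr ⟨(s, r), hzip, rfl, hrs, hr0⟩

/-- After the degrees up to `D`, the output of the algorithm contains the leading monomials of all
homogeneous elements of the ideal of degree at most `D`, up to divisibility. -/
theorem exists_mem_output_of_mem_span (hF : ∀ i, (F i).IsHomogeneous (F i).totalDegree)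
    (hpos : ∀ i, 0 < (F i).totalDegree) {d D : ℕ} (hdD : d ≤ D) {p : MvPolynomial (Fin n) K}
    (hp : p ∈ Ideal.span (Set.range F)) (hpd : p.IsHomogeneous d) (hp0 : p ≠ 0) :
    ∃ g ∈ output F D, g ≠ 0 ∧ (grevlex n).degree g ≤ (grevlex n).degree p := by
  rw [← prefixIdeal_eq_span_range le_rfl] at hp
  obtain ⟨r, hr, -, hr0, hdeg⟩ := (tableSpec hF hpos d).exists_degree_eq hF hp hpd hp0
  obtain ⟨g, hg, hg0, hle⟩ := exists_mem_output_of_mem_table d r hr hr0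
  exact ⟨g, output_mono hdD hg, hg0, hdeg ▸ hle⟩

end Correctness

end MatrixF5

/-! ### The substitution of powers for the variables -/

section WeightedSubstitution

variable {K : Type*} [Field K] {n m : ℕ} {w : Fin n → ℕ}

/-- The exponent vector of the image of a monomial under the substitution `X i ↦ X i ^ w i`. -/
noncomputable def scaleExp (w : Fin n → ℕ) (u : Fin n →₀ ℕ) : Fin n →₀ ℕ :=
  Finsupp.equivFunOnFinite.symm fun i => w i * u i

@[simp] theorem scaleExp_apply (u : Fin n →₀ ℕ) (i : Fin n) : scaleExp w u i = w i * u i := rfl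

theorem scaleExp_injective (hw : ∀ i, 0 < w i) : Function.Injective (scaleExp w) := by
  intro u v h
  ext i
  have := DFunLike.congr_fun h i
  simpa [(hw i).ne'] using this

theorem scaleExp_mono {u v : Fin n →₀ ℕ} (h : u ≤ v) : scaleExp w u ≤ scaleExp w v :=
  fun i => Nat.mul_le_mul_left _ (h i)

theorem degree_scaleExp (u : Fin n →₀ ℕ) : (scaleExp w u).degree = Finsupp.weight w u := by
  simp [Finsupp.degree_eq_sum, Finsupp.weight_apply, Finsupp.sum_fintype, mul_comm]

theorem homW_monomial (u : Fin n →₀ ℕ) (c : K) :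
    homW w (monomial u c) = monomial (scaleExp w u) c := by
  rw [homW, aeval_monomial, monomial_eq, Finsupp.prod_fintype _ _ (by simp),
    Finsupp.prod_fintype _ _ (by simp)]
  simp [← pow_mul, algebraMap_eq]

theorem coeff_homW (hw : ∀ i, 0 < w i) (p : MvPolynomial (Fin n) K) (u : Fin n →₀ ℕ) :
    (homW w p).coeff (scaleExp w u) = p.coeff u := by
  classical
  induction p using MvPolynomial.induction_on' with
  | monomial v c =>
    rw [homW_monomial, coeff_monomial, coeff_monomial]
    simp [(scaleExp_injective hw).eq_iff]
  | add p q hp hq => rw [map_add, coeff_add, coeff_add, hp, hq]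

theorem exists_of_mem_support_homW {p : MvPolynomial (Fin n) K} {v : Fin n →₀ ℕ}
    (hv : v ∈ (homW w p).support) : ∃ u ∈ p.support, v = scaleExp w u := by
  classical
  rw [p.as_sum, map_sum] at hv
  obtain ⟨u, hu, hv⟩ := Finset.mem_biUnion.1 (support_sum hv)
  rw [homW_monomial] at hv
  exact ⟨u, hu, Finset.mem_singleton.1 (support_monomial_subset hv)⟩

theorem isHomogeneous_homW {p : MvPolynomial (Fin n) K} {d : ℕ}
    (hp : IsWeightedHomogeneous w p d) : (homW w p).IsHomogeneous d := by
  intro v hv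
  obtain ⟨u, hu, rfl⟩ := exists_of_mem_support_homW (mem_support_iff.2 hv)
  have h1 : Finsupp.weight (1 : Fin n → ℕ) (scaleExp w u) = (scaleExp w u).degree := by
    rw [Finsupp.degree_eq_weight_one]
    rfl
  rw [h1, degree_scaleExp]
  exact hp (mem_support_iff.1 hu)

theorem homW_ne_zero (hw : ∀ i, 0 < w i) {p : MvPolynomial (Fin n) K} (hp : p ≠ 0) :
    homW w p ≠ 0 := by
  obtain ⟨u, hu⟩ := ne_zero_iff.1 hp
  exact ne_zero_iff.2 ⟨scaleExp w u, by rwa [coeff_homW hw]⟩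

theorem homW_mem_span {f : Fin m → MvPolynomial (Fin n) K} {p : MvPolynomial (Fin n) K}
    (hp : p ∈ Ideal.span (Set.range f)) :
    homW w p ∈ Ideal.span (Set.range fun i => homW w (f i)) := by
  have h := Ideal.mem_map_of_mem (homW (K := K) w) hp
  rwa [Ideal.map_span, ← Set.range_comp] at h

open Classical in
/-- The polynomial formed by the terms of a polynomial whose exponent vector is congruent to `a`
modulo the weights, where the exponents are divided by the weights. As `a` runs through the
remainders, these maps are the coordinates of the polynomial ring as a free module over the image of
the substitution `X i ↦ X i ^ w i`. -/
noncomputable def residuePart (w : Fin n → ℕ) (a : Fin n →₀ ℕ) :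
    MvPolynomial (Fin n) K →ₗ[K] MvPolynomial (Fin n) K :=
  (basisMonomials (Fin n) K).constr K fun u =>
    if ∀ i, u i % w i = a i then
      monomial (Finsupp.equivFunOnFinite.symm fun i => u i / w i) 1 else 0

open Classical in
theorem residuePart_monomial (a u : Fin n →₀ ℕ) (c : K) :
    residuePart w a (monomial u c) = if ∀ i, u i % w i = a i then
      monomial (Finsupp.equivFunOnFinite.symm fun i => u i / w i) c else 0 := by
  have h1 : monomial u c = c • basisMonomials (Fin n) K u := by
    simp [smul_monomial]
  rw [h1, map_smul, residuePart, Module.Basis.constr_basis]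
  split_ifs
  · rw [smul_monomial, smul_eq_mul, mul_one]
  · rw [smul_zero]

theorem residuePart_mul_homW (hw : ∀ i, 0 < w i) (a : Fin n →₀ ℕ) (p q : MvPolynomial (Fin n) K) :
    residuePart w a (p * homW w q) = residuePart w a p * q := by
  induction q using MvPolynomial.induction_on' with
  | monomial v c =>
    induction p using MvPolynomial.induction_on' with
    | monomial u b =>
      rw [homW_monomial, monomial_mul, residuePart_monomial, residuePart_monomial]
      have h1 : ∀ i, (u + scaleExp w v) i % w i = u i % w i := fun i => by simp
      simp only [h1]
      split_ifs
      · rw [monomial_mul]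
        refine congrArg (fun x => monomial x (b * c)) (Finsupp.ext fun i => ?_)
        simp [Nat.add_mul_div_left _ _ (hw i)]
      · rw [zero_mul]
    | add p p' hp hp' => rw [add_mul, map_add, map_add, hp, hp', add_mul]
  | add q q' hq hq' => rw [map_add, mul_add, map_add, hq, hq', mul_add]

theorem coeff_residuePart (hw : ∀ i, 0 < w i) {a : Fin n →₀ ℕ} (ha : ∀ i, a i < w i)
    (p : MvPolynomial (Fin n) K) (u : Fin n →₀ ℕ) :
    (residuePart w a p).coeff u = p.coeff (a + scaleExp w u) := by
  classical
  induction p using MvPolynomial.induction_on' with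
  | monomial v c =>
    rw [residuePart_monomial, coeff_monomial]
    split_ifs with h1 h2 h2
    · rw [coeff_monomial, if_pos]
      ext i
      simp [h2, Nat.add_mul_div_left _ _ (hw i), Nat.div_eq_of_lt (ha i)]
    · rw [coeff_monomial, if_neg]
      rintro rfl
      refine h2 (Finsupp.ext fun i => ?_)
      simp [← h1 i, Nat.mod_add_div]
    · refine absurd (fun i => ?_) h1
      simp [h2, Nat.mod_eq_of_lt (ha i)]
    · rw [coeff_zero]
  | add p q hp hq => rw [map_add, coeff_add, coeff_add, hp, hq]

theorem residuePart_mem_span (hw : ∀ i, 0 < w i) (a : Fin n →₀ ℕ)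
    {f : Fin m → MvPolynomial (Fin n) K} {p : MvPolynomial (Fin n) K}
    (hp : p ∈ Ideal.span (Set.range fun i => homW w (f i))) :
    residuePart w a p ∈ Ideal.span (Set.range f) := by
  obtain ⟨c, rfl⟩ := Ideal.mem_span_range_iff_exists_fun.1 hp
  rw [map_sum]
  refine Ideal.sum_mem _ fun i _ => ?_
  rw [residuePart_mul_homW hw]
  exact Ideal.mul_mem_left _ _ (Ideal.subset_span (Set.mem_range_self i))

theorem exists_le_weight_mem_Ioc {N : ℕ} (u : Fin n →₀ ℕ) (hu : N < Finsupp.weight w u) :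
    ∃ v ≤ u, N < Finsupp.weight w v ∧ Finsupp.weight w v ≤ N + Finset.univ.sup w := by
  induction h : u.degree generalizing u with
  | zero =>
    rw [(Finsupp.degree_eq_zero_iff u).1 h] at hu
    simp at hu
  | succ k ih =>
    by_cases hle : Finsupp.weight w u ≤ N + Finset.univ.sup w
    · exact ⟨u, le_rfl, hu, hle⟩
    · have hu0 : u ≠ 0 := by rintro rfl; simp at hu
      obtain ⟨v, i, rfl, -⟩ := MatrixF5.exists_add_single_of_ne_zero hu0
      have hwi : w i ≤ Finset.univ.sup w := Finset.le_sup (Finset.mem_univ i)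
      rw [map_add, Finsupp.weight_single, one_smul] at hle
      rw [map_add, Finsupp.degree_single] at h
      obtain ⟨v', hv', h1, h2⟩ := ih v (by omega) (by omega)
      exact ⟨v', hv'.trans le_self_add, h1, h2⟩

/-- The leading monomials of the ideal generated by the `homW w (f i)` are multiples of leading
monomials of homogeneous elements of degree at most `N + max w`, if all polynomials of weighted
degree larger than `N` lie in the ideal generated by the `f i`. -/
theorem exists_homogeneous_degree_le (hw : ∀ i, 0 < w i) {f : Fin m → MvPolynomial (Fin n) K}
    {d : Fin m → ℕ} (hf : ∀ i, IsWeightedHomogeneous w (f i) (d i)) {N : ℕ}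
    (hN : ∀ e, N < e →
      weightedHomogeneousSubmodule K w e ≤ (Ideal.span (Set.range f)).restrictScalars K)
    {p : MvPolynomial (Fin n) K} (hp : p ∈ Ideal.span (Set.range fun i => homW w (f i)))
    (hp0 : p ≠ 0) :
    ∃ e ≤ N + Finset.univ.sup w, ∃ h ∈ Ideal.span (Set.range fun i => homW w (f i)),
      h.IsHomogeneous e ∧ h ≠ 0 ∧ (grevlex n).degree h ≤ (grevlex n).degree p := by
  classical
  set v := (grevlex n).degree p with hv
  let a : Fin n →₀ ℕ := Finsupp.equivFunOnFinite.symm fun i => v i % w i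
  let b : Fin n →₀ ℕ := Finsupp.equivFunOnFinite.symm fun i => v i / w i
  have hab : a + scaleExp w b = v := by
    ext i
    simp [a, b, Nat.mod_add_div]
  have ha : ∀ i, a i < w i := fun i => Nat.mod_lt _ (hw i)
  -- In small degree, the component of `residuePart w a p` has the leading exponent vector `b`; in
  -- large degree, a monomial dividing the one of `b` lies in the ideal.
  by_cases hb : Finsupp.weight w b ≤ N
  · let g := weightedHomogeneousComponent w (Finsupp.weight w b) (residuePart w a p)
    have hcoeff : ∀ u, g.coeff u =
        if Finsupp.weight w u = Finsupp.weight w b then p.coeff (a + scaleExp w u) else 0 := by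
      intro u
      rw [coeff_weightedHomogeneousComponent, coeff_residuePart hw ha]
    have hgb : g.coeff b ≠ 0 := by
      rw [hcoeff, if_pos rfl, hab]
      exact (grevlex n).coeff_degree_ne_zero_iff.2 hp0
    have hgmem : g ∈ Ideal.span (Set.range f) := by
      have h1 := residuePart_mem_span hw a hp
      rw [← Set.image_univ] at h1 ⊢
      exact weightedHomogeneousComponent_mem_span_image hf h1 _
    refine ⟨Finsupp.weight w b, by omega, homW w g, homW_mem_span hgmem,
      isHomogeneous_homW (weightedHomogeneousComponent_isWeightedHomogeneous _ _),
      homW_ne_zero hw (ne_zero_iff.2 ⟨b, hgb⟩), ?_⟩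
    have hdeg : (grevlex n).degree (homW w g) = scaleExp w b := by
      apply (grevlex n).toSyn.injective
      apply le_antisymm
      · rw [MonomialOrder.degree_le_iff]
        intro v' hv'
        obtain ⟨u, hu, rfl⟩ := exists_of_mem_support_homW hv'
        rw [mem_support_iff, hcoeff] at hu
        have hu' : a + scaleExp w u ∈ p.support := by
          rw [mem_support_iff]
          rintro h0
          simp [h0] at hu
        have h2 := (grevlex n).le_degree hu'
        rw [← hv, ← hab, map_add, map_add] at h2
        exact le_of_add_le_add_left h2
      · refine (grevlex n).le_degree ?_
        rw [mem_support_iff, coeff_homW hw]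
        exact hgb
    rw [hdeg, ← hab]
    exact le_add_self
  · obtain ⟨u, hub, h1, h2⟩ := exists_le_weight_mem_Ioc b (not_le.1 hb)
    have hu : IsWeightedHomogeneous w (monomial u (1 : K)) (Finsupp.weight w u) :=
      isWeightedHomogeneous_monomial w u 1 rfl
    refine ⟨Finsupp.weight w u, h2, homW w (monomial u 1), homW_mem_span (hN _ h1 hu),
      isHomogeneous_homW hu, homW_ne_zero hw (by simp), ?_⟩
    rw [homW_monomial, MonomialOrder.degree_monomial, if_neg one_ne_zero, ← hab]
    exact (scaleExp_mono hub).trans le_add_self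

/-- The degrees in a regular sequence of homogeneous polynomials are at most `N + max w`, if all
polynomials of weighted degree larger than `N` lie in the ideal. Otherwise a member of the sequence
would lie in the ideal generated by the other members. -/
theorem degree_le_of_forall_mem (hw : ∀ i, 0 < w i) {f : Fin m → MvPolynomial (Fin n) K}
    {d : Fin m → ℕ} (hf : ∀ i, IsWeightedHomogeneous w (f i) (d i))
    (hreg : ∀ (j : Fin m) a, a * f j ∈ prefixIdeal f j → a ∈ prefixIdeal f j)
    (hne : Ideal.span (Set.range f) ≠ ⊤) {N : ℕ}
    (hN : ∀ e, N < e →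
      weightedHomogeneousSubmodule K w e ≤ (Ideal.span (Set.range f)).restrictScalars K)
    (j : Fin m) : d j ≤ N + Finset.univ.sup w := by
  classical
  by_contra hlt
  have hmem : f j ∈ Ideal.span (f '' ((Finset.univ.erase j : Finset (Fin m)) : Set (Fin m))) := by
    rw [(f j).as_sum]
    refine Ideal.sum_mem _ fun u hu => ?_
    have hwu := hf j (mem_support_iff.1 hu)
    have hu0 : u ≠ 0 := by
      rintro rfl
      simp at hwu
      omega
    obtain ⟨v, i, rfl, -⟩ := MatrixF5.exists_add_single_of_ne_zero hu0
    have hwi : w i ≤ Finset.univ.sup w := Finset.le_sup (Finset.mem_univ i)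
    rw [map_add, Finsupp.weight_single, one_smul] at hwu
    have hv : IsWeightedHomogeneous w (monomial v (1 : K)) (Finsupp.weight w v) :=
      isWeightedHomogeneous_monomial w v 1 rfl
    have hvI : monomial v (1 : K) ∈ Ideal.span (Set.range f) := hN _ (by omega) hv
    rw [← Set.image_univ] at hvI
    have h1 := weightedHomogeneousComponent_mem_span hf hvI (Finsupp.weight w v)
    rw [weightedHomogeneousComponent_eq_self hv] at h1
    have h2 : monomial v (1 : K) ∈
        (Ideal.span (f '' ((Finset.univ.erase j : Finset (Fin m)) : Set (Fin m)))).restrictScalars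
          K := by
      refine Submodule.span_le.2 ?_ h1
      rintro _ ⟨k, -, u, hu, rfl⟩
      refine Ideal.mul_mem_left _ _ (Ideal.subset_span ⟨k, ?_, rfl⟩)
      have := hw i
      simp only [Finset.coe_erase, Finset.coe_univ, Set.mem_sdiff, Set.mem_univ, true_and,
        Set.mem_singleton_iff]
      rintro rfl
      omega
    have h3 : monomial (v + Finsupp.single i 1) (coeff (v + Finsupp.single i 1) (f j)) =
        monomial (Finsupp.single i 1) (coeff (v + Finsupp.single i 1) (f j)) * monomial v 1 := by
      rw [monomial_mul, mul_one, add_comm]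
    rw [h3]
    exact Ideal.mul_mem_left _ _ h2
  -- The relation between the members of the sequence in which the coefficient of `f j` is `1`.
  obtain ⟨c, hc⟩ :=
    (Submodule.mem_span_image_finset_iff_exists_fun' (MvPolynomial (Fin n) K)).1 hmem
  have h1 := coeff_mem_of_sum_mul_eq_zero hreg (fun k => if k = j then 1 else -c k) (by
    rw [← Finset.add_sum_erase _ _ (Finset.mem_univ j), if_pos rfl, one_mul, ← hc,
      ← Finset.sum_add_distrib]
    refine Finset.sum_eq_zero fun k hk => ?_
    rw [if_neg (Finset.ne_of_mem_erase hk)]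
    simp) j
  rw [if_pos rfl] at h1
  exact hne ((Ideal.eq_top_iff_one _).2 h1)

end WeightedSubstitution

/-! ### Degree and degree of regularity -/

theorem mainTheorem1 {K : Type*} [Field K] {n : ℕ} (w d : Fin n → ℕ) (hw : ∀ i, 0 < w i)
    (f : Fin n → MvPolynomial (Fin n) K)
    (hf : ∀ i, MvPolynomial.IsWeightedHomogeneous w (f i) (d i))
    (hreg : RingTheory.Sequence.IsRegular (MvPolynomial (Fin n) K) (List.ofFn f)) :
    (VarietyIsOrigin (Ideal.span (Set.range f)) ∧
      Module.Finite K (MvPolynomial (Fin n) K ⧸ Ideal.span (Set.range f)) ∧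
      (zeroDimDegree (Ideal.span (Set.range f)) : ℚ) = ∏ i, (d i : ℚ) / (w i : ℚ)) ∧
    ∃ D : ℕ, degreeOfRegularity w f = (D : ℕ∞) ∧
      (D : ℤ) ≤ ∑ i, ((d i : ℤ) - (w i : ℤ)) + ((Finset.univ.sup w : ℕ) : ℤ) := by
  have hreg' : ∀ (j : Fin n) a, a * f j ∈ prefixIdeal f j → a ∈ prefixIdeal f j :=
    mem_prefixIdeal_of_isWeaklyRegular hreg.toIsWeaklyRegular
  have hI : Ideal.span (Set.range f) ≠ ⊤ := by
    have h1 := hreg.top_ne_smul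
    rw [smul_eq_mul, Ideal.mul_top, Ideal.ofList] at h1
    simpa [Set.range, List.mem_ofFn] using h1.symm
  have hf0 : ∀ j, f j ≠ 0 := fun j h0 => hI ((Ideal.eq_top_iff_one _).2
    (prefixIdeal_le_span_range j (hreg' j 1 (by rw [h0, mul_zero]; exact zero_mem _))))
  have hd : ∀ j, 0 < d j := by
    intro j
    by_contra hdj
    have h0 : ∀ u ∈ (f j).support, u = 0 := by
      intro u hu
      have h1 := hf j (mem_support_iff.1 hu)
      rw [← degree_scaleExp, Nat.eq_zero_of_not_pos hdj, Finsupp.degree_eq_zero_iff] at h1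
      exact scaleExp_injective hw (by rw [h1]; ext; simp)
    have h1 : f j = C ((f j).coeff 0) := by
      ext u
      rw [coeff_C]
      split_ifs with h
      · rw [h]
      · by_contra h2
        exact h (h0 u (mem_support_iff.2 h2)).symm
    have h2 : (f j).coeff 0 ≠ 0 := fun h => hf0 j (by rw [h1, h, C_0])
    refine hI (Ideal.eq_top_of_isUnit_mem _ (Ideal.subset_span (Set.mem_range_self j)) ?_)
    rw [h1]
    exact (isUnit_iff_ne_zero.2 h2).map C
  obtain ⟨P, hP, hPdeg, hPeval⟩ := exists_polynomial_eq_hilbertSeries hw hd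
    (hilbertSeries_prefixIdeal_mul_prod hw hf hf0 hreg')
  have hN : ∀ e, P.natDegree < e →
      weightedHomogeneousSubmodule K w e ≤ (Ideal.span (Set.range f)).restrictScalars K :=
    fun e he => weightedHomogeneousSubmodule_le_of_coeff_eq_zero hw (by
      rw [← hP, Polynomial.coeff_coe, Polynomial.coeff_eq_zero_of_natDegree_lt he])
  have hcomp : ∀ p ∈ Ideal.span (Set.range f), ∀ e,
      weightedHomogeneousComponent w e p ∈ Ideal.span (Set.range f) := fun p hp e => by
    rw [← Set.image_univ] at hp ⊢
    exact weightedHomogeneousComponent_mem_span_image hf hp e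
  obtain ⟨hfin, hrank⟩ := finite_and_finrank_quotient_of_hilbertSeries_eq hw hcomp hP
  refine ⟨⟨varietyIsOrigin_of_le hw hN ?_, hfin, ?_⟩, ?_⟩
  · have h1 : Ideal.span (Set.range f) ≤ RingHom.ker (constantCoeff (σ := Fin n) (R := K)) := by
      rw [Ideal.span_le]
      rintro _ ⟨j, rfl⟩
      exact (hf j).coeff_eq_zero 0 (by rw [map_zero]; exact (hd j).ne)
    exact fun p hp => h1 hp
  · rw [Finset.prod_div_distrib, eq_div_iff (Finset.prod_ne_zero_iff.2 fun i _ => by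
      exact_mod_cast (hw i).ne'), zeroDimDegree]
    rw [← hrank] at hPeval
    exact_mod_cast hPeval
  · set F := fun i => homW w (f i) with hFdef
    have hF : ∀ i, (F i).totalDegree = d i := fun i =>
      (isHomogeneous_homW (hf i)).totalDegree (homW_ne_zero hw (hf0 i))
    have hFhom : ∀ i, (F i).IsHomogeneous (F i).totalDegree := fun i => by
      rw [hF]
      exact isHomogeneous_homW (hf i)
    have hFpos : ∀ i, 0 < (F i).totalDegree := fun i => by rw [hF]; exact hd i
    have hcomplete : F5Complete w f (P.natDegree + Finset.univ.sup w) := by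
      refine ⟨fun i => ?_, MatrixF5.output_subset hFhom hFpos _, fun p hp hp0 => ?_⟩
      · exact (hF i).trans_le (degree_le_of_forall_mem hw hf hreg' hI hN i)
      · obtain ⟨e, he, h, hh, hhom, hh0, hle⟩ := exists_homogeneous_degree_le hw hf hN hp hp0
        obtain ⟨g, hg, hg0, hgle⟩ :=
          MatrixF5.exists_mem_output_of_mem_span hFhom hFpos he hh hhom hh0
        exact ⟨g, hg, hg0, hgle.trans hle⟩
    have hle : degreeOfRegularity w f ≤ ((P.natDegree + Finset.univ.sup w : ℕ) : ℕ∞) :=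
      iInf₂_le _ hcomplete
    obtain ⟨D, hD⟩ := ENat.ne_top_iff_exists.1 (ne_top_of_le_ne_top (ENat.natCast_ne_top _) hle)
    refine ⟨D, hD.symm, ?_⟩
    rw [← hD, Nat.cast_le] at hle
    rw [Finset.sum_sub_distrib]
    zify at hle hPdeg
    linarith
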